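/- Let $\mathcal X$ be a real separable Hilbert space and $\rho$ a probability measure on $\mathcal X\times\mathbb R$ with marginal $\rho_{\mathcal X}$ on $\mathcal X$. Assume that there is $\kappa>0$ with $\langle x,x'\rangle\le\kappa^2$ for $\rho_{\mathcal X}$-almost all $x,x'$, that there is $M>0$ with $|y|<M$ $\rho$-almost surely, and that the expected risk $\mathcal E(w)=\int(\langle w,x\rangle-y)^2\,d\rho(x,y)$ has a minimizer $w^*\in\mathcal X$, i.e. $\mathcal E(w^*)=\inf_{\mathcal X}\mathcal E$. Let $(x_1,y_1),\dots,(x_n,y_n)$ be i.i.d. samples from $\rho$, and put $G(w)=\frac1n\sum_{i=1}^n(\langle w,x_i\rangle-y_i)\,x_i$. Consider the following iterations, defined for $t\ge 0$ and with $\hat w_{-1}=\hat w_0=0$. * Gradient descent: $\hat w_{t+1}=\hat w_t-\alpha G(\hat w_t)$, where $0<\alpha<1/\kappa^2$. * Heavy ball (the $\nu$-method), $\nu>1$: $\hat w_{t+1}=\hat w_t-\alpha_{t+1}G(\hat w_t)+\beta_{t+1}(\hat w_t-\hat w_{t-1})$, where for $t\ge1$ $$\alpha_t=\frac{4}{\kappa^2}\,\frac{(2t+2\nu-1)(t+\nu-1)}{(t+2\nu-1)(2t+4\nu-1)},\qquad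 \beta_t=\frac{(t-1)(2t-3)(2t+2\nu-1)}{(t+2\nu-1)(2t+4\nu-1)(2t+2\nu-3)}.$$ * Nesterov: $\hat w_{t+1}=\hat v_t-\alpha G(\hat v_t)$, $\hat v_t=\hat w_t+\frac{t-1}{t+\beta}(\hat w_t-\hat w_{t-1})$, where $0<\alpha<1/\kappa^2$ and $\beta\ge1$. Let $\hat w^{GD}_t$ be the $t$-th iterate of gradient descent and $\hat w^{acc}_t$ that of heavy ball or of Nesterov's method. Then there are constants $C_1,c_1,C_2,c_2>0$, which may depend on $\rho,\kappa,M$ and on the method with its parameters but not on $n,t,\delta$, such that for all $\delta\in(0,1/2)$ and all integers $n,t\ge1$: 1. if $n$ is so large that $n\ge c_1t\log\frac{c_1t}{\delta}$, then with probability at least $1-\delta$ $$\mathcal E(\hat w^{GD}_t)-\inf_{\mathcal X}\mathcal E\le C_1\Big(\frac1t+\frac tn\Big)\log^2\frac2\delta;$$ 2. if $n$ is so large that $n\ge c_2t^2\log\frac{c_2t^2}{\delta}$, then with probability at least $1-\delta$ $$\mathcal E(\hat w^{acc}_t)-\inf_{\mathcal X}\mathcal E\le C_2\Big(\frac1{t^2}+\frac{t^2}n\Big)\log^2\frac2\delta.$$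 Moreover, for stopping rules $t^{GD}=t^{GD}(n)$ of exact order $n^{1/2}$ (that is, $t^{GD}=\Theta(n^{1/2})$), respectively $t^{acc}=t^{acc}(n)$ of exact order $n^{1/4}$, there is a constant $C$ independent of $n$ and $\delta$ such that for every $\delta\in(0,1/2)$ and all $n$ large enough (depending on $\delta$), with probability at least $1-\delta$, the excess risk $\mathcal E(\hat w_t)-\inf_{\mathcal X}\mathcal E$ of the method at its stopping time is at most $\frac{C}{\sqrt n}\log^2\frac2\delta$; this holds both for gradient descent and for the accelerated methods. -/

import Mathlib

open MeasureTheory Filter Asymptotics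

noncomputable section

namespace LeastSquares

variable {H : Type*} [NormedAddCommGroup H] [InnerProductSpace ℝ H]

/-- The expected risk `𝓔(w) = ∫ (⟨w, x⟩ - y)² dρ(x, y)`. -/
def risk [MeasurableSpace H] (ρ : Measure (H × ℝ)) (w : H) : ℝ :=
  ∫ p, (inner ℝ w p.1 - p.2) ^ 2 ∂ρ

/-- The excess risk `𝓔(w) - inf_{v ∈ H} 𝓔(v)`. -/
def excessRisk [MeasurableSpace H] (ρ : Measure (H × ℝ)) (w : H) : ℝ :=
  risk ρ w - ⨅ v : H, risk ρ v

/-- The sampling operator `X : H → ℝⁿ`, `(X w)ᵢ = ⟨w, xᵢ⟩`, of a sample `zᵢ = (xᵢ, yᵢ)`. -/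
def samplingOp {n : ℕ} (z : Fin n → H × ℝ) (w : H) : Fin n → ℝ :=
  fun i => inner ℝ w (z i).1

/-- The operator `X* : ℝⁿ → H`, `X* u = (1/n) ∑ᵢ uᵢ xᵢ` (the adjoint of `X` for the Euclidean
inner product of `ℝⁿ` divided by `n`). -/
def samplingAdj {n : ℕ} (z : Fin n → H × ℝ) (u : Fin n → ℝ) : H :=
  (1 / (n : ℝ)) • ∑ i, u i • (z i).1

/-- The vector `X* (X w - y)`. -/
def empGrad {n : ℕ} (z : Fin n → H × ℝ) (w : H) : H :=
  samplingAdj z (fun i => samplingOp z w i - (z i).2)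

/-- A learning method: for every sample size `n`, every sample and every `t`, the `t`-th iterate. -/
abbrev Method (H : Type*) : Type _ := (n : ℕ) → (Fin n → H × ℝ) → ℕ → H

/-- Gradient descent, `w₀ = 0`, `w_{t+1} = w_t - α X* (X w_t - y)`. -/
def gradientDescent (α : ℝ) : Method H := fun _ z t =>
  Nat.rec 0 (fun _ w => w - α • empGrad z w) t

/-- The step size `α_t` (`t ≥ 1`) of heavy ball. For `t = 1` and `ν > 0` it equals
`(4ν + 2) / (κ² (4ν + 1))`. -/
def heavyBallStep (κ ν : ℝ) (t : ℕ) : ℝ :=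
  4 / κ ^ 2 * (((2 * t + 2 * ν - 1) * (t + ν - 1)) / ((t + 2 * ν - 1) * (2 * t + 4 * ν - 1)))

/-- The momentum parameter `β_t` (`t ≥ 1`) of heavy ball; `β₁ = 0`. -/
def heavyBallMomentum (ν : ℝ) (t : ℕ) : ℝ :=
  ((t - 1) * (2 * t - 3) * (2 * t + 2 * ν - 1)) /
    ((t + 2 * ν - 1) * (2 * t + 4 * ν - 1) * (2 * t + 2 * ν - 3))

/-- The pair `(w_{t-1}, w_t)` of heavy ball, `w_{-1} = w₀ = 0`,
`w_{t+1} = w_t - α_{t+1} X* (X w_t - y) + β_{t+1} (w_t - w_{t-1})`. -/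
def heavyBallState (κ ν : ℝ) {n : ℕ} (z : Fin n → H × ℝ) : ℕ → H × H
  | 0 => (0, 0)
  | t + 1 =>
    let u := (heavyBallState κ ν z t).1
    let w := (heavyBallState κ ν z t).2
    (w, w - heavyBallStep κ ν (t + 1) • empGrad z w + heavyBallMomentum ν (t + 1) • (w - u))

/-- The heavy-ball method with varying parameters (the `ν`-method). -/
def heavyBall (κ ν : ℝ) : Method H := fun _ z t => (heavyBallState κ ν z t).2

/-- The pair `(w_{t-1}, w_t)` of Nesterov's method, `w_{-1} = w₀ = 0`,
`v_t = w_t + β_t (w_t - w_{t-1})`, `w_{t+1} = v_t - α X* (X v_t - y)`, `β_t = (t - 1) / (t + β)`. -/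
def nesterovState (α β : ℝ) {n : ℕ} (z : Fin n → H × ℝ) : ℕ → H × H
  | 0 => (0, 0)
  | t + 1 =>
    let u := (nesterovState α β z t).1
    let w := (nesterovState α β z t).2
    let v := w + (((t : ℝ) - 1) / ((t : ℝ) + β)) • (w - u)
    (w, v - α • empGrad z v)

/-- Nesterov's accelerated gradient method. -/
def nesterov (α β : ℝ) : Method H := fun _ z t => (nesterovState α β z t).2

/-- `w` is gradient descent with an admissible step size. -/
def IsGradientDescent (κ : ℝ) (w : Method H) : Prop :=
  ∃ α : ℝ, 0 < α ∧ α < 1 / κ ^ 2 ∧ w = gradientDescent α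

/-- `w` is one of the two accelerated methods, with admissible parameters. -/
def IsAccelerated (κ : ℝ) (w : Method H) : Prop :=
  (∃ ν : ℝ, 1 < ν ∧ w = heavyBall κ ν) ∨
    (∃ α β : ℝ, 0 < α ∧ α < 1 / κ ^ 2 ∧ 1 ≤ β ∧ w = nesterov α β)

/-- The law of `n` i.i.d. samples drawn from `ρ`. -/
def sampleLaw [MeasurableSpace H] (ρ : Measure (H × ℝ)) (n : ℕ) : Measure (Fin n → H × ℝ) :=
  Measure.pi fun _ => ρ

end LeastSquares

end

/-!
Let `w*` minimize the risk, `q(v) = ∫ ⟨v, x⟩² dρ`, `q̂(v) = (1/n) ∑ ⟨v, xᵢ⟩²`, and let `φ(t)` be `t`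
for gradient descent and `t²` for the accelerated methods. By the normal equations the excess risk
of `w` is `q(w - w*)` (`excessRisk_eq`). Three facts bound it.

*Optimization.* Along an eigenvector of the empirical covariance with eigenvalue `σ`, the error
`ŵ_t - w*` is `-⟨w*, e⟩ r_t(σ)` plus a response to the noise `ξ = X*(X w* - y)`. The residual
polynomials `r_t` satisfy `|r_t| ≤ 1` and `σ φ(t) r_t² ≤ C`, which gives
`q̂(ŵ_t - w*) + ‖ŵ_t - w*‖² / φ(t) ≤ K (‖w*‖² / φ(t) + φ(t) ‖ξ‖²)` (`IsSpectralFilter.norm_bound`).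
For both accelerated methods `r_t` is expressed by normalized Gegenbauer polynomials `Q_m` with
parameter `l ≥ 1`: it is `Q_{2t}(x)` with `l = 2ν`, `x² = 1 - σ/κ²` for heavy ball, and
`x^{t+1} Q_{t-1}(x)` with `2l = β + 1`, `x² = 1 - ασ` for Nesterov. Two quadratic energies that
decrease along the three-term recurrence give `|Q_m| ≤ 1` and `(1 - x²) (m + l)² Q_m² ≤ C`.

*Noise.* `ξ` is a mean of independent centred bounded vectors, so `‖ξ‖ ≤ C log(2/δ) / √n` with high
probability (`measure_norm_sum_ge_le`). The proof bounds the mean of `cosh ‖S + ξ‖`, using that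
`s ↦ cosh √s` is convex.

*Covariance.* If `n ≥ c φ log(c φ / δ)`, then with high probability `q ≤ 2 q̂ + 2 κ² ‖·‖² / φ`
uniformly in `v` (`measure_lower_tail`). In coordinates one follows the barrier `tr M⁻ᵖ`, where `M`
starts at `n κ² I` and changes by `xᵢ xᵢᵀ - Σ/2` with each sample point. A resolvent identity and
Chebyshev's sum inequality show that the rank-one term lowers `tr M⁻ᵖ` by at least half of its
linear effect; by Klein's inequality this compensates, on average, for the subtraction of `Σ/2`.
After removal of its first-order part at `n κ² I`, the barrier has mean at most a quantity free of
the dimension, and with `p` of order `n` Markov's inequality gives exponential tails. Since the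
bound is free of the dimension, it extends from finite-dimensional subspaces to `H`.

At the stopping times `φ` is of exact order `√n`, and the two terms `1/φ` and `φ/n` balance.
-/

namespace LeastSquares

/-! ### Normalized Gegenbauer polynomials -/

/-- The Gegenbauer polynomial of degree `m` and parameter `l`, normalized to the value `1` at
`x = 1`. -/
noncomputable def normGegenbauer (l x : ℝ) : ℕ → ℝ
  | 0 => 1
  | 1 => x
  | m + 2 => (2 * (m + 1 + l) * x * normGegenbauer l x (m + 1) - (m + 1) * normGegenbauer l x m) /
      (m + 1 + 2 * l)

lemma normGegenbauer_rec {l : ℝ} (hl : 0 < l) (x : ℝ) (m : ℕ) :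
    (m + 1 + 2 * l) * normGegenbauer l x (m + 2) =
      2 * (m + 1 + l) * x * normGegenbauer l x (m + 1) - (m + 1) * normGegenbauer l x m := by
  have : (m + 1 + 2 * l : ℝ) ≠ 0 := by positivity
  rw [normGegenbauer]
  field_simp

lemma normGegenbauer_one {l : ℝ} (hl : 0 < l) (m : ℕ) : normGegenbauer l 1 m = 1 := by
  induction m using Nat.twoStepInduction with
  | zero => rfl
  | one => rfl
  | more m h₀ h₁ =>
    have h := normGegenbauer_rec hl 1 m
    rw [h₀, h₁] at h
    have : (m + 1 + 2 * l : ℝ) ≠ 0 := by positivity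
    apply mul_left_cancel₀ this
    linarith

/-- The quadratic form `Q_{m+1}² - 2 x Q_m Q_{m+1} + Q_m²` does not increase in `m`: written around
`Q_{m+1}`, its two consecutive values are `(Q_{m+2} - x Q_{m+1})² + (1 - x²) Q_{m+1}²` and
`(Q_m - x Q_{m+1})² + (1 - x²) Q_{m+1}²`, and the recurrence makes the first square the smaller. -/
lemma normGegenbauer_energy_le {l : ℝ} (hl : 0 < l) (x : ℝ) (m : ℕ) :
    (normGegenbauer l x (m + 1) - x * normGegenbauer l x m) ^ 2 +
      (1 - x ^ 2) * normGegenbauer l x m ^ 2 ≤ 1 - x ^ 2 := by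
  induction m with
  | zero => simp [normGegenbauer]
  | succ m ih =>
    have h := normGegenbauer_rec hl x m
    set a := normGegenbauer l x m
    set b := normGegenbauer l x (m + 1)
    set c := normGegenbauer l x (m + 2)
    have hm : (0 : ℝ) ≤ m := Nat.cast_nonneg m
    have hpos : (0 : ℝ) < m + 1 + 2 * l := by positivity
    have h1 : (m + 1 + 2 * l) * (c - x * b) = -((m + 1) * (a - x * b)) := by linear_combination h
    have h2 : (c - x * b) ^ 2 ≤ (a - x * b) ^ 2 := by
      rw [sq_le_sq]
      have h3 := congrArg abs h1
      rw [abs_neg, abs_mul, abs_mul, abs_of_pos hpos,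
        abs_of_pos (by positivity : (0 : ℝ) < m + 1)] at h3
      have h4 : (m + 1 + 2 * l) * |c - x * b| ≤ (m + 1 + 2 * l) * |a - x * b| := by
        rw [h3]
        exact mul_le_mul_of_nonneg_right (by linarith) (abs_nonneg _)
      exact le_of_mul_le_mul_left h4 hpos
    have h5 : (a - x * b) ^ 2 + (1 - x ^ 2) * b ^ 2 = (b - x * a) ^ 2 + (1 - x ^ 2) * a ^ 2 := by
      ring
    linarith

lemma abs_normGegenbauer_le_one {l x : ℝ} (hl : 0 < l) (hx₀ : 0 ≤ x) (hx₁ : x ≤ 1) (m : ℕ) :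
    |normGegenbauer l x m| ≤ 1 := by
  rcases hx₁.eq_or_lt with rfl | hx
  · simp [normGegenbauer_one hl]
  · have h := normGegenbauer_energy_le hl x m
    have h1 : 0 < 1 - x ^ 2 := by nlinarith
    rw [← sq_le_one_iff_abs_le_one]
    have h2 : (1 - x ^ 2) * normGegenbauer l x m ^ 2 ≤ (1 - x ^ 2) * 1 := by
      nlinarith [sq_nonneg (normGegenbauer l x (m + 1) - x * normGegenbauer l x m)]
    exact le_of_mul_le_mul_left h2 h1

/-- For `l ≥ 1` and `Z_m = (m + l) Q_m` the quantity
`Z_{m+1}² - 2 x Z_m Z_{m+1} + Z_m² + (l - 1) (Q_{m+1}² + Q_m²)` does not increase in `m`: its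
increment is `-(l - 1) (m + 1 + l) (Q_{m+2} - Q_m)²`. -/
lemma normGegenbauer_weightedEnergy_le {l x : ℝ} (hl : 1 ≤ l) (hx₀ : 0 ≤ x) (hx₁ : x ≤ 1) (m : ℕ) :
    ((m + 1 + l) * normGegenbauer l x (m + 1)) ^ 2
        - 2 * x * ((m + l) * normGegenbauer l x m) * ((m + 1 + l) * normGegenbauer l x (m + 1))
        + ((m + l) * normGegenbauer l x m) ^ 2
        + (l - 1) * (normGegenbauer l x (m + 1) ^ 2 + normGegenbauer l x m ^ 2)
      ≤ 4 * (l + 1) ^ 2 := by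
  induction m with
  | zero =>
    simp only [normGegenbauer, Nat.cast_zero]
    have hx2 : x ^ 2 ≤ 1 := by nlinarith
    nlinarith [sq_nonneg x, mul_nonneg (sub_nonneg.2 hl) (sub_nonneg.2 hx2),
      mul_nonneg (mul_nonneg (sub_nonneg.2 hl) (sub_nonneg.2 hl)) (sub_nonneg.2 hx2)]
  | succ m ih =>
    have h := normGegenbauer_rec (by linarith : 0 < l) x m
    set a := normGegenbauer l x m
    set b := normGegenbauer l x (m + 1)
    set c := normGegenbauer l x (m + 2)
    have hm : (0 : ℝ) ≤ m := Nat.cast_nonneg m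
    have h1 : 0 ≤ (l - 1) * ((m + 1 + l) * (c - a) ^ 2) :=
      mul_nonneg (by linarith) (mul_nonneg (by linarith) (sq_nonneg _))
    push_cast
    refine le_trans (le_of_eq ?_) (le_trans (sub_le_self _ h1) ih)
    linear_combination ((m + 2 + l) * c - (m + l) * a) * h

lemma one_sub_sq_mul_normGegenbauer_sq_le {l x : ℝ} (hl : 1 ≤ l) (hx₀ : 0 ≤ x) (hx₁ : x ≤ 1)
    (m : ℕ) : (1 - x ^ 2) * (m + l) ^ 2 * normGegenbauer l x m ^ 2 ≤ 4 * (l + 1) ^ 2 := by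
  refine le_trans ?_ (normGegenbauer_weightedEnergy_le hl hx₀ hx₁ m)
  have h1 : 0 ≤ (l - 1) * (normGegenbauer l x (m + 1) ^ 2 + normGegenbauer l x m ^ 2) :=
    mul_nonneg (by linarith) (by positivity)
  nlinarith [sq_nonneg ((m + 1 + l) * normGegenbauer l x (m + 1)
    - x * ((m + l) * normGegenbauer l x m))]

/-- The three-term recurrence of the even-degree polynomials `Q_{2t}`, in `s = 1 - x²`; its
coefficients, for `l = 2ν`, are those of the `ν`-method. -/
lemma normGegenbauer_even_rec {ν x : ℝ} (hν : 1 < ν) (t : ℕ) :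
    normGegenbauer (2 * ν) x (2 * (t + 2)) =
      normGegenbauer (2 * ν) x (2 * (t + 1))
      - 4 * (((2 * (t + 2) + 2 * ν - 1) * (t + 2 + ν - 1)) /
          ((t + 2 + 2 * ν - 1) * (2 * (t + 2) + 4 * ν - 1))) *
        ((1 - x ^ 2) * normGegenbauer (2 * ν) x (2 * (t + 1)))
      + heavyBallMomentum ν (t + 2) * (normGegenbauer (2 * ν) x (2 * (t + 1)) -
        normGegenbauer (2 * ν) x (2 * t)) := by
  have h0 := normGegenbauer_rec (by linarith : 0 < 2 * ν) x (2 * t)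
  have h1 := normGegenbauer_rec (by linarith : 0 < 2 * ν) x (2 * t + 1)
  have h2 := normGegenbauer_rec (by linarith : 0 < 2 * ν) x (2 * t + 2)
  rw [show 2 * (t + 2) = 2 * t + 2 + 2 by ring, show 2 * (t + 1) = 2 * t + 2 by ring,
    heavyBallMomentum]
  rw [show 2 * t + 1 + 2 = 2 * t + 2 + 1 by ring, show 2 * t + 1 + 1 = 2 * t + 2 by ring] at h1
  set a := normGegenbauer (2 * ν) x (2 * t)
  set b := normGegenbauer (2 * ν) x (2 * t + 1)
  set c := normGegenbauer (2 * ν) x (2 * t + 2)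
  set d := normGegenbauer (2 * ν) x (2 * t + 2 + 1)
  set e := normGegenbauer (2 * ν) x (2 * t + 2 + 2)
  push_cast at h0 h1 h2 ⊢
  have hm : (0 : ℝ) ≤ t := Nat.cast_nonneg t
  -- In terms of `p = t + 1 + 2ν` the three denominators are `p`, `2p + 1` and `p + t`.
  obtain ⟨p, rfl⟩ : ∃ p, ν = (p - t - 1) / 2 := ⟨t + 1 + 2 * ν, by ring⟩
  have p1 : p ≠ 0 := by linarith
  have p2 : 2 * p + 1 ≠ 0 := by linarith
  have p3 : p + t ≠ 0 := by linarith
  have e2 : e = ((2 * t + 4 + 2 * p) * (x * d) - (2 * t + 3) * c) / (2 * p + 1) := by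
    rw [eq_div_iff p2]; linear_combination h2
  have e1 : x * d = ((2 * t + 2 + 2 * p) * x ^ 2 * c - (2 * t + 2) * (x * b)) / (2 * p) := by
    rw [eq_div_iff (by simpa using p1)]; linear_combination x * h1
  have e0 : x * b = ((2 * p - 1) * c + (2 * t + 1) * a) / (2 * (p + t)) := by
    rw [eq_div_iff (by simpa using p3)]; linear_combination -h0
  rw [e2, e1, e0, show (t + 2 + 2 * ((p - t - 1) / 2) - 1 : ℝ) = p by ring,
    show (2 * (t + 2) + 4 * ((p - t - 1) / 2) - 1 : ℝ) = 2 * p + 1 by ring,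
    show (2 * (t + 2) + 2 * ((p - t - 1) / 2) - 3 : ℝ) = p + t by ring]
  field_simp
  ring

/-! ### Momentum schemes on an eigenspace -/

/-- `f` is generated by the two-step scheme with steps `a` and momenta `b`, `c`, started without
momentum, for the (affine) gradient map `G`. Gradient descent has `b = c = 0`, heavy ball has
`c = 0`, and Nesterov's method has `b = c`. -/
def IsMomentumScheme (a b c : ℕ → ℝ) {E : Type*} [AddCommGroup E] [Module ℝ E] (G : E → E)
    (f : ℕ → E) : Prop :=
  f 1 = f 0 - a 0 • G (f 0) ∧ ∀ t, f (t + 2) =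
    f (t + 1) + b t • (f (t + 1) - f t) - a (t + 1) • G (f (t + 1) + c t • (f (t + 1) - f t))

section Scalar

variable {a b c r d : ℕ → ℝ} {σ ζ A : ℝ}

/-- On an eigenspace with eigenvalue `σ`, the error of the scheme is `d₀ r + e`, where `r` is the
residual polynomial at `σ` and `e` is the response to the noise `ζ`; the latter satisfies
`σ e = ζ (1 - r)`. -/
lemma IsMomentumScheme.eigenvalue_mul_sub (hr : IsMomentumScheme a b c (fun v => σ * v) r)
    (hr₀ : r 0 = 1) (hd : IsMomentumScheme a b c (fun v => σ * v - ζ) d) (t : ℕ) :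
    σ * (d t - d 0 * r t) = ζ * (1 - r t) := by
  obtain ⟨hr1, hr2⟩ := hr
  obtain ⟨hd1, hd2⟩ := hd
  simp only [smul_eq_mul] at *
  induction t using Nat.twoStepInduction with
  | zero => simp [hr₀]
  | one => rw [hd1, hr1, hr₀]; ring
  | more t h0 h1 =>
    rw [hd2, hr2]
    linear_combination (-b t + a (t + 1) * c t * σ) * h0 +
      (1 + b t - a (t + 1) * (1 + c t) * σ) * h1

lemma IsMomentumScheme.abs_sub_le_sq (hr : IsMomentumScheme a b c (fun v => σ * v) r)
    (hr₀ : r 0 = 1) (hr_le : ∀ t, |r t| ≤ 1)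
    (hd : IsMomentumScheme a b c (fun v => σ * v - ζ) d)
    (ha : ∀ t, |a t| ≤ A) (hb : ∀ t, |b t| ≤ 1) (hc : ∀ t, |c t| ≤ 1) (t : ℕ) :
    |d t - d 0 * r t| ≤ 3 * A * |ζ| * (t : ℝ) ^ 2 := by
  have hA : 0 ≤ A := (abs_nonneg _).trans (ha 0)
  have key := hr.eigenvalue_mul_sub hr₀ hd
  obtain ⟨hr1, hr2⟩ := hr
  obtain ⟨hd1, hd2⟩ := hd
  simp only [smul_eq_mul] at *
  have hB : 0 ≤ A * |ζ| := by positivity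
  have incr : ∀ t, |(d (t + 1) - d 0 * r (t + 1)) - (d t - d 0 * r t)| ≤
      3 * A * |ζ| * (t + 1) := by
    intro t
    induction t with
    | zero =>
      have : (d 1 - d 0 * r 1) - (d 0 - d 0 * r 0) = a 0 * ζ := by
        rw [hd1, hr1, hr₀]; ring
      rw [zero_add, this, abs_mul]
      have := mul_le_mul_of_nonneg_right (ha 0) (abs_nonneg ζ)
      push_cast
      nlinarith
    | succ t ih =>
      have h1 : (d (t + 2) - d 0 * r (t + 2)) - (d (t + 1) - d 0 * r (t + 1)) =
          b t * ((d (t + 1) - d 0 * r (t + 1)) - (d t - d 0 * r t)) +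
            a (t + 1) * ζ * (r (t + 1) + c t * (r (t + 1) - r t)) := by
        rw [hd2, hr2]
        linear_combination -(a (t + 1) * (1 + c t)) * key (t + 1) + a (t + 1) * c t * key t
      rw [show t + 1 + 1 = t + 2 by rfl, h1]
      have h2 : |r (t + 1) + c t * (r (t + 1) - r t)| ≤ 3 := by
        refine (abs_add_le _ _).trans ?_
        rw [abs_mul]
        have := (abs_sub (r (t + 1)) (r t)).trans (add_le_add (hr_le _) (hr_le _))
        have := mul_le_mul (hc t) this (abs_nonneg _) zero_le_one
        linarith [hr_le (t + 1)]
      have h3 : |a (t + 1) * ζ * (r (t + 1) + c t * (r (t + 1) - r t))| ≤ A * |ζ| * 3 := by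
        rw [abs_mul, abs_mul]
        exact mul_le_mul (mul_le_mul_of_nonneg_right (ha _) (abs_nonneg _)) h2 (abs_nonneg _) hB
      have h4 : |b t * ((d (t + 1) - d 0 * r (t + 1)) - (d t - d 0 * r t))| ≤
          3 * A * |ζ| * (t + 1) := by
        rw [abs_mul]
        calc _ ≤ 1 * |(d (t + 1) - d 0 * r (t + 1)) - (d t - d 0 * r t)| :=
              mul_le_mul_of_nonneg_right (hb t) (abs_nonneg _)
          _ ≤ _ := by linarith
      push_cast
      linarith [abs_add_le (b t * ((d (t + 1) - d 0 * r (t + 1)) - (d t - d 0 * r t)))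
        (a (t + 1) * ζ * (r (t + 1) + c t * (r (t + 1) - r t)))]
  induction t with
  | zero => simp [hr₀]
  | succ t ih =>
    have h1 := incr t
    have h2 := abs_add_le ((d (t + 1) - d 0 * r (t + 1)) - (d t - d 0 * r t)) (d t - d 0 * r t)
    rw [sub_add_cancel] at h2
    push_cast
    nlinarith [mul_nonneg hB (Nat.cast_nonneg (α := ℝ) t)]

/-- Without momentum the noise response grows only linearly. -/
lemma IsMomentumScheme.abs_sub_le_of_no_momentum
    (hr : IsMomentumScheme a 0 0 (fun v => σ * v) r)
    (hr₀ : r 0 = 1) (hr_le : ∀ t, |r t| ≤ 1)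
    (hd : IsMomentumScheme a 0 0 (fun v => σ * v - ζ) d) (ha : ∀ t, |a t| ≤ A) (t : ℕ) :
    |d t - d 0 * r t| ≤ A * |ζ| * t := by
  have key := hr.eigenvalue_mul_sub hr₀ hd
  obtain ⟨hr1, hr2⟩ := hr
  obtain ⟨hd1, hd2⟩ := hd
  simp only [smul_eq_mul, Pi.zero_apply, zero_mul, add_zero] at *
  have incr : ∀ t, (d (t + 1) - d 0 * r (t + 1)) = (d t - d 0 * r t) + a t * ζ * r t := by
    intro t
    cases t with
    | zero => rw [zero_add, hd1, hr1, hr₀]; ring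
    | succ t => rw [hd2, hr2]; linear_combination -a (t + 1) * key (t + 1)
  induction t with
  | zero => simp [hr₀]
  | succ t ih =>
    rw [incr]
    refine (abs_add_le _ _).trans ?_
    have : |a t * ζ * r t| ≤ A * |ζ| * 1 := by
      rw [abs_mul, abs_mul]
      exact mul_le_mul (mul_le_mul_of_nonneg_right (ha _) (abs_nonneg _)) (hr_le t)
        (abs_nonneg _) (mul_nonneg ((abs_nonneg _).trans (ha 0)) (abs_nonneg _))
    push_cast
    linarith

end Scalar

/-- The scheme acts as a spectral filter with qualification at least `1/2` and regularization
parameter `1 / φ t`: on an eigenspace with eigenvalue `σ ∈ [0, κ²]`, the error `d` after `t` steps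
is controlled, in the norm of `(σ + 1 / φ t)^{1/2}`, by the initial error and the noise. -/
def IsSpectralFilter (κ : ℝ) (a b c : ℕ → ℝ) (φ : ℕ → ℝ) (K : ℝ) : Prop :=
  ∀ (σ ζ : ℝ) (d : ℕ → ℝ), 0 ≤ σ → σ ≤ κ ^ 2 → IsMomentumScheme a b c (fun v => σ * v - ζ) d →
    ∀ t : ℕ, 1 ≤ t → (σ + 1 / φ t) * d t ^ 2 ≤ K * (d 0 ^ 2 / φ t + φ t * ζ ^ 2)

/-- The error `d = d₀ r + e` splits into bias and noise; `σ e² = e ζ (1 - r)` takes care of the noise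
in the norm weighted by `σ`. -/
lemma filter_bound_of_residual {σ ζ d₀ d r φ K : ℝ} (hφ : 0 < φ) (hK : 0 ≤ K) (hσ : 0 ≤ σ)
    (hr : |r| ≤ 1) (hσr : σ * r ^ 2 * φ ≤ K) (he : |d - d₀ * r| ≤ K * |ζ| * φ)
    (hσe : σ * (d - d₀ * r) = ζ * (1 - r)) :
    (σ + 1 / φ) * d ^ 2 ≤ 2 * (K + 1) ^ 2 * (d₀ ^ 2 / φ + φ * ζ ^ 2) := by
  set e := d - d₀ * r
  have hd : d ^ 2 ≤ 2 * (d₀ ^ 2 * r ^ 2) + 2 * e ^ 2 := by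
    have : d = d₀ * r + e := by simp [e]
    rw [this]; nlinarith [sq_nonneg (d₀ * r - e)]
  have hr2 : r ^ 2 ≤ 1 := (sq_le_one_iff_abs_le_one r).2 hr
  have h1 : (σ * φ + 1) * (d₀ ^ 2 * r ^ 2) ≤ (K + 1) * d₀ ^ 2 := by
    nlinarith [sq_nonneg d₀]
  have h2 : σ * e ^ 2 ≤ 2 * K * φ * ζ ^ 2 := by
    calc σ * e ^ 2 = ζ * (1 - r) * e := by rw [← hσe]; ring
      _ ≤ |ζ * (1 - r) * e| := le_abs_self _
      _ = |ζ| * |1 - r| * |e| := by rw [abs_mul, abs_mul]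
      _ ≤ |ζ| * 2 * (K * |ζ| * φ) := by
        gcongr
        exact (abs_sub _ _).trans (by rw [abs_one]; linarith)
      _ = 2 * K * φ * |ζ| ^ 2 := by ring
      _ = _ := by rw [sq_abs]
  have h3 : e ^ 2 ≤ K ^ 2 * ζ ^ 2 * φ ^ 2 := by
    rw [← sq_abs e, ← sq_abs ζ]
    calc |e| ^ 2 ≤ (K * |ζ| * φ) ^ 2 := by gcongr
      _ = _ := by ring
  have h4 : (σ * φ + 1) * e ^ 2 ≤ (2 * K + K ^ 2) * (φ ^ 2 * ζ ^ 2) := by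
    nlinarith [mul_le_mul_of_nonneg_left h2 hφ.le]
  have h5 : (σ * φ + 1) * d ^ 2 ≤ 2 * (K + 1) ^ 2 * (d₀ ^ 2 + φ ^ 2 * ζ ^ 2) := by
    have h6 : (σ * φ + 1) * d ^ 2 ≤ (σ * φ + 1) * (2 * (d₀ ^ 2 * r ^ 2) + 2 * e ^ 2) := by
      gcongr
    nlinarith [sq_nonneg d₀, mul_nonneg hK (sq_nonneg d₀), sq_nonneg (K * d₀),
      sq_nonneg (φ * ζ)]
  have h7 : (σ + 1 / φ) * d ^ 2 = (σ * φ + 1) * d ^ 2 / φ := by field_simp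
  rw [h7, div_le_iff₀ hφ]
  refine h5.trans (le_of_eq ?_)
  field_simp

lemma isSpectralFilter_gradientDescent {κ α : ℝ} (hα : 0 < α) (hακ : α * κ ^ 2 < 1) :
    ∃ K, 0 < K ∧ IsSpectralFilter κ (fun _ => α) 0 0 (fun t => (t : ℝ)) K := by
  refine ⟨2 * ((1 / α + α) + 1) ^ 2, by positivity, fun σ ζ d hσ hσκ hd t ht => ?_⟩
  have hs : α * σ ≤ 1 := (mul_le_mul_of_nonneg_left hσκ hα.le).trans hακ.le
  have hs0 : 0 ≤ α * σ := by positivity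
  have hr : IsMomentumScheme (fun _ => α) 0 0 (fun v => σ * v) (fun t => (1 - α * σ) ^ t) := by
    constructor
    · simp
    · intro t
      simp only [Pi.zero_apply, smul_eq_mul, zero_mul, add_zero]
      ring
  have hr_le : ∀ t : ℕ, |(1 - α * σ) ^ t| ≤ 1 := fun t => by
    rw [abs_pow]
    exact pow_le_one₀ (abs_nonneg _) (abs_le.2 ⟨by linarith, by linarith⟩)
  have ht0 : (0 : ℝ) < t := by exact_mod_cast ht
  refine filter_bound_of_residual ht0 (by positivity) hσ (hr_le t) ?_ ?_
    (hr.eigenvalue_mul_sub (by simp) hd t)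
  · -- Bernoulli: `(1 - s) ^ t * (1 + t s) ≤ ((1 - s) (1 + s)) ^ t ≤ 1`.
    have h1 : (1 - α * σ) ^ t * (1 + t * (α * σ)) ≤ 1 := by
      calc (1 - α * σ) ^ t * (1 + t * (α * σ)) ≤ (1 - α * σ) ^ t * (1 + α * σ) ^ t := by
            apply mul_le_mul_of_nonneg_left _ (pow_nonneg (by linarith) _)
            exact one_add_mul_le_pow (by linarith) t
        _ = ((1 - α * σ) * (1 + α * σ)) ^ t := by rw [mul_pow]
        _ ≤ 1 := pow_le_one₀ (mul_nonneg (by linarith) (by linarith)) (by nlinarith)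
    have h2 : 0 ≤ (1 - α * σ) ^ t := pow_nonneg (by linarith) _
    have h3 : (1 - α * σ) ^ t ≤ 1 := pow_le_one₀ (by linarith) (by linarith)
    have h4 : α * (σ * ((1 - α * σ) ^ t) ^ 2 * t) ≤ 1 := by nlinarith
    have h5 : σ * ((1 - α * σ) ^ t) ^ 2 * t ≤ 1 / α := by
      rw [le_div_iff₀ hα]; linarith
    linarith
  · have := hr.abs_sub_le_of_no_momentum (by simp) hr_le hd
      (A := α) (fun _ => (abs_of_pos hα).le) t
    refine this.trans ?_
    have : 0 ≤ 1 / α := by positivity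
    gcongr
    linarith

lemma isSpectralFilter_heavyBall {κ ν : ℝ} (hκ : 0 < κ) (hν : 1 < ν) :
    ∃ K, 0 < K ∧ IsSpectralFilter κ (fun t => heavyBallStep κ ν (t + 1))
      (fun t => heavyBallMomentum ν (t + 2)) 0 (fun t => (t : ℝ) ^ 2) K := by
  refine ⟨2 * ((κ ^ 2 * (4 * (2 * ν + 1) ^ 2) + 3 * (4 / κ ^ 2)) + 1) ^ 2, by positivity,
    fun σ ζ d hσ hσκ hd t ht => ?_⟩
  have hs0 : 0 ≤ σ / κ ^ 2 := by positivity
  have hs1 : σ / κ ^ 2 ≤ 1 := by rw [div_le_one (by positivity)]; exact hσκ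
  set x := √(1 - σ / κ ^ 2) with hx
  have hx2 : x ^ 2 = 1 - σ / κ ^ 2 := Real.sq_sqrt (by linarith)
  have hx0 : 0 ≤ x := Real.sqrt_nonneg _
  have hx1 : x ≤ 1 := by rw [hx]; exact Real.sqrt_le_one.2 (by linarith)
  have hσx : σ = κ ^ 2 * (1 - x ^ 2) := by rw [hx2]; field_simp; ring
  have hr : IsMomentumScheme (fun t => heavyBallStep κ ν (t + 1))
      (fun t => heavyBallMomentum ν (t + 2)) 0 (fun v => σ * v)
      (fun t => normGegenbauer (2 * ν) x (2 * t)) := by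
    constructor
    · have h1 : (1 + 4 * ν : ℝ) ≠ 0 := by positivity
      have h2 : (4 * ν + 1 : ℝ) ≠ 0 := by positivity
      have h3 : ν ≠ 0 := by positivity
      simp only [heavyBallStep, normGegenbauer, smul_eq_mul, hσx]
      push_cast
      rw [show (1 + 2 * ν - 1 : ℝ) = 2 * ν by ring, show (1 + ν - 1 : ℝ) = ν by ring,
        show (2 * 1 + 4 * ν - 1 : ℝ) = 4 * ν + 1 by ring,
        show (0 + 1 + 2 * (2 * ν) : ℝ) = 4 * ν + 1 by ring]
      field_simp
      ring
    · intro t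
      simp only [smul_eq_mul, Pi.zero_apply, zero_mul, add_zero]
      rw [normGegenbauer_even_rec hν, heavyBallStep, hσx]
      push_cast
      rw [show (t + 1 + 1 : ℝ) = t + 2 by ring]
      field_simp
      ring
  have hr_le : ∀ t, |normGegenbauer (2 * ν) x (2 * t)| ≤ 1 := fun t =>
    abs_normGegenbauer_le_one (by linarith) hx0 hx1 _
  have ht0 : (0 : ℝ) < (t : ℝ) ^ 2 := by positivity
  have hstep : ∀ t : ℕ, |heavyBallStep κ ν (t + 1)| ≤ 4 / κ ^ 2 := fun t => by
    have ht : (0 : ℝ) ≤ t := Nat.cast_nonneg t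
    have h1 : (0 : ℝ) < t + 2 * ν := by linarith
    have h2 : (0 : ℝ) < 2 * t + 4 * ν + 1 := by linarith
    rw [heavyBallStep, abs_mul, abs_of_pos (by positivity : 0 < 4 / κ ^ 2)]
    refine mul_le_of_le_one_right (by positivity) ?_
    push_cast
    rw [show (t + 1 + 2 * ν - 1 : ℝ) = t + 2 * ν by ring,
      show (2 * (t + 1) + 4 * ν - 1 : ℝ) = 2 * t + 4 * ν + 1 by ring,
      show (2 * (t + 1) + 2 * ν - 1 : ℝ) = 2 * t + 2 * ν + 1 by ring,
      show (t + 1 + ν - 1 : ℝ) = t + ν by ring, abs_of_nonneg (by positivity),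
      div_le_one (by positivity)]
    nlinarith
  have hmom : ∀ t : ℕ, |heavyBallMomentum ν (t + 2)| ≤ 1 := fun t => by
    have ht : (0 : ℝ) ≤ t := Nat.cast_nonneg t
    rw [heavyBallMomentum]
    push_cast
    rw [show (t + 2 - 1 : ℝ) = t + 1 by ring, show (2 * (t + 2) - 3 : ℝ) = 2 * t + 1 by ring,
      show (2 * (t + 2) + 2 * ν - 1 : ℝ) = 2 * t + 2 * ν + 3 by ring,
      show (t + 2 + 2 * ν - 1 : ℝ) = t + 2 * ν + 1 by ring,
      show (2 * (t + 2) + 4 * ν - 1 : ℝ) = 2 * t + 4 * ν + 3 by ring,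
      show (2 * (t + 2) + 2 * ν - 3 : ℝ) = 2 * t + 2 * ν + 1 by ring,
      abs_of_nonneg (by positivity), div_le_one (by positivity), mul_assoc, mul_assoc]
    exact mul_le_mul (by linarith) (by nlinarith) (by positivity) (by positivity)
  have hc4 : 0 < 4 / κ ^ 2 := by positivity
  refine filter_bound_of_residual ht0 (by positivity) hσ (hr_le t) ?_ ?_
    (hr.eigenvalue_mul_sub (by simp [normGegenbauer]) hd t)
  · have h1 := one_sub_sq_mul_normGegenbauer_sq_le (by linarith : 1 ≤ 2 * ν) hx0 hx1 (2 * t)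
    have h2 : (t : ℝ) ^ 2 ≤ (((2 * t : ℕ) : ℝ) + 2 * ν) ^ 2 := by
      push_cast
      have ht : (0 : ℝ) ≤ t := Nat.cast_nonneg t
      gcongr
      linarith
    have h3 : 0 ≤ 1 - x ^ 2 := by nlinarith
    have h4 : (1 - x ^ 2) * (t : ℝ) ^ 2 * normGegenbauer (2 * ν) x (2 * t) ^ 2 ≤
        4 * (2 * ν + 1) ^ 2 := le_trans (by gcongr) h1
    have h5 := mul_le_mul_of_nonneg_left h4 (sq_nonneg κ)
    rw [hσx]
    linarith
  · refine (hr.abs_sub_le_sq (by simp [normGegenbauer]) hr_le hd hstep hmom (by simp) t).trans ?_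
    gcongr
    have : 0 ≤ κ ^ 2 * (4 * (2 * ν + 1) ^ 2) := by positivity
    linarith

lemma isSpectralFilter_nesterov {κ α β : ℝ} (hα : 0 < α) (hακ : α * κ ^ 2 < 1) (hβ : 1 ≤ β) :
    ∃ K, 0 < K ∧ IsSpectralFilter κ (fun _ => α) (fun t => (t : ℝ) / (t + 1 + β))
      (fun t => (t : ℝ) / (t + 1 + β)) (fun t => (t : ℝ) ^ 2) K := by
  set l := (β + 1) / 2 with hl
  have hl1 : 1 ≤ l := by linarith
  refine ⟨2 * ((1 / α * (4 * (l + 1) ^ 2) + 3 * α) + 1) ^ 2, by positivity,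
    fun σ ζ d hσ hσκ hd t ht => ?_⟩
  have hs : α * σ ≤ 1 := (mul_le_mul_of_nonneg_left hσκ hα.le).trans hακ.le
  have hs0 : 0 ≤ α * σ := by positivity
  set x := √(1 - α * σ) with hx
  have hx2 : x ^ 2 = 1 - α * σ := Real.sq_sqrt (by linarith)
  have hx0 : 0 ≤ x := Real.sqrt_nonneg _
  have hx1 : x ≤ 1 := by rw [hx]; exact Real.sqrt_le_one.2 (by linarith)
  have hσx : σ = 1 / α * (1 - x ^ 2) := by rw [hx2]; field_simp; ring
  -- The residual polynomials of Nesterov's method are `x ^ (t + 1) * Q_{t - 1}` for `t ≥ 1`.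
  set r : ℕ → ℝ := fun t => Nat.casesOn t 1 (fun m => x ^ (m + 2) * normGegenbauer l x m) with hrdef
  have hrs : ∀ m, r (m + 1) = x ^ (m + 2) * normGegenbauer l x m := fun m => rfl
  have hr0 : r 0 = 1 := rfl
  have hr : IsMomentumScheme (fun _ => α) (fun t => (t : ℝ) / (t + 1 + β))
      (fun t => (t : ℝ) / (t + 1 + β)) (fun v => σ * v) r := by
    constructor
    · rw [← zero_add 1, hrs, hr0]
      simp [normGegenbauer, hx2]
    · intro t
      simp only [smul_eq_mul]
      have hstep : ∀ v, v - α * (σ * v) = x ^ 2 * v := fun v => by rw [hx2]; ring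
      rw [hstep, hrs]
      cases t with
      | zero =>
        rw [hrs]
        simp [normGegenbauer]
        ring
      | succ m =>
        have h := normGegenbauer_rec (by linarith : 0 < l) x m
        have h2 : (m + 1 + 2 * l : ℝ) ≠ 0 := by positivity
        have h3 : ((m : ℝ) + 1 + 1 + β) = m + 1 + 2 * l := by rw [hl]; ring
        rw [hrs, hrs]
        push_cast
        rw [h3, eq_comm, ← sub_eq_zero]
        field_simp
        linear_combination -x ^ (m + 4) * h
  have hr_le : ∀ t, |r t| ≤ 1 := fun t => by
    cases t with
    | zero => simp [hr0]
    | succ m =>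
      rw [hrs, abs_mul, abs_of_nonneg (by positivity)]
      exact mul_le_one₀ (pow_le_one₀ hx0 hx1) (abs_nonneg _)
        (abs_normGegenbauer_le_one (by linarith) hx0 hx1 _)
  have ht0 : (0 : ℝ) < (t : ℝ) ^ 2 := by positivity
  have hmom : ∀ t : ℕ, |(t : ℝ) / (t + 1 + β)| ≤ 1 := fun t => by
    have ht : (0 : ℝ) ≤ t := Nat.cast_nonneg t
    rw [abs_of_nonneg (by positivity), div_le_one (by positivity)]
    linarith
  refine filter_bound_of_residual ht0 (by positivity) hσ (hr_le t) ?_ ?_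
    (hr.eigenvalue_mul_sub hr0 hd t)
  · obtain ⟨m, rfl⟩ : ∃ m, t = m + 1 := ⟨t - 1, by omega⟩
    have h1 := one_sub_sq_mul_normGegenbauer_sq_le hl1 hx0 hx1 m
    have h2 : ((m + 1 : ℕ) : ℝ) ^ 2 ≤ (m + l) ^ 2 := by
      push_cast
      gcongr
    have h3 : 0 ≤ 1 - x ^ 2 := by nlinarith
    have h4 : (x ^ (m + 2)) ^ 2 ≤ 1 := pow_le_one₀ (by positivity) (pow_le_one₀ hx0 hx1)
    have h5 : (1 - x ^ 2) * ((m + 1 : ℕ) : ℝ) ^ 2 * normGegenbauer l x m ^ 2 ≤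
        4 * (l + 1) ^ 2 := le_trans (by gcongr) h1
    have h6 : (x ^ (m + 2)) ^ 2 * ((1 - x ^ 2) * ((m + 1 : ℕ) : ℝ) ^ 2 *
        normGegenbauer l x m ^ 2) ≤ 4 * (l + 1) ^ 2 :=
      (mul_le_of_le_one_left (by positivity) h4).trans h5
    have h7 := mul_le_mul_of_nonneg_left h6 (by positivity : 0 ≤ 1 / α)
    rw [hrs, hσx]
    linarith
  · refine (hr.abs_sub_le_sq hr0 hr_le hd (fun _ => (abs_of_pos hα).le) hmom hmom t).trans ?_
    gcongr
    have : 0 ≤ 1 / α * (4 * (l + 1) ^ 2) := by positivity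
    linarith

/-! ### From eigenspaces to the Hilbert space -/

variable {H : Type*} [NormedAddCommGroup H] [InnerProductSpace ℝ H]

lemma inner_empGrad {n : ℕ} (z : Fin n → H × ℝ) (w e : H) :
    inner ℝ e (empGrad z w) =
      (1 / (n : ℝ)) * ∑ i, (inner ℝ w (z i).1 - (z i).2) * inner ℝ e (z i).1 := by
  simp [empGrad, samplingAdj, samplingOp, inner_smul_right, inner_sum]

/-- A finite orthonormal family of eigenvectors of the empirical covariance operator
`v ↦ (1/n) ∑ᵢ ⟨v, xᵢ⟩ xᵢ`, which spans a given finite-dimensional subspace containing the sample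
(only Parseval's identity on that subspace is recorded). -/
lemma exists_empCov_eigenvectors {n : ℕ} (x : Fin n → H) (V : Submodule ℝ H)
    [FiniteDimensional ℝ V] (hx : ∀ i, x i ∈ V) :
    ∃ (d : ℕ) (e : Fin d → H) (σ : Fin d → ℝ), (∀ j, ‖e j‖ = 1) ∧
      (∀ j w, (1 / (n : ℝ)) * ∑ i, inner ℝ w (x i) * inner ℝ (e j) (x i) =
        σ j * inner ℝ (e j) w) ∧
      ∀ v ∈ V, ∀ w ∈ V, inner ℝ v w = ∑ j, inner ℝ (e j) v * inner ℝ (e j) w := by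
  let y : Fin n → V := fun i => ⟨x i, hx i⟩
  let A : V →ₗ[ℝ] V := (1 / (n : ℝ)) • ∑ i, (innerₛₗ ℝ (y i)).smulRight (y i)
  have hAv : ∀ v, A v = (1 / (n : ℝ)) • ∑ i, (inner ℝ (y i) v : ℝ) • y i := fun v => by
    simp [A]
  have hA : A.IsSymmetric := fun v w => by
    rw [hAv, hAv, inner_smul_left, inner_smul_right, sum_inner, inner_sum]
    congr 1
    refine Finset.sum_congr rfl fun i _ => ?_
    rw [inner_smul_left, inner_smul_right, real_inner_comm v (y i)]
    simp [mul_comm]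
  let b := hA.eigenvectorBasis rfl
  refine ⟨_, fun j => (b j : H), hA.eigenvalues rfl, fun j => ?_, fun j w => ?_,
    fun v hv w hw => ?_⟩
  · exact b.orthonormal.1 j
  · have h1 : ((A (b j) : V) : H) = hA.eigenvalues rfl j • (b j : H) := by
      rw [show A (b j) = _ from hA.apply_eigenvectorBasis rfl j]
      rfl
    have h2 : inner ℝ ((A (b j) : V) : H) w = hA.eigenvalues rfl j * inner ℝ (b j : H) w := by
      rw [h1, inner_smul_left]; simp
    rw [← h2, hAv]
    simp only [Submodule.coe_smul, Submodule.coe_sum, inner_smul_left, sum_inner, y,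
      Submodule.coe_inner]
    simp [real_inner_comm, mul_comm]
  · have := b.sum_inner_mul_inner (⟨v, hv⟩ : V) ⟨w, hw⟩
    simp only [Submodule.coe_inner] at this
    rw [← this]
    simp [real_inner_comm]

lemma IsMomentumScheme.mem {a b c : ℕ → ℝ} {n : ℕ} {z : Fin n → H × ℝ} {W : ℕ → H}
    (hW : IsMomentumScheme a b c (empGrad z) W) (h0 : W 0 = 0) {V : Submodule ℝ H}
    (hV : ∀ i, (z i).1 ∈ V) (t : ℕ) : W t ∈ V := by
  have hG : ∀ w, empGrad z w ∈ V := fun w =>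
    V.smul_mem _ (V.sum_mem fun i _ => V.smul_mem _ (hV i))
  induction t using Nat.twoStepInduction with
  | zero => simp [h0]
  | one => rw [hW.1, h0]; exact V.sub_mem V.zero_mem (V.smul_mem _ (hG _))
  | more t h₀ h₁ =>
    rw [hW.2]
    exact V.sub_mem (V.add_mem h₁ (V.smul_mem _ (V.sub_mem h₁ h₀))) (V.smul_mem _ (hG _))

/-- The spectral filter bound, summed over the eigenvectors of the empirical covariance. The noise
is the empirical gradient at the target `v`. -/
lemma IsSpectralFilter.norm_bound {κ K : ℝ} {a b c φ : ℕ → ℝ} (hf : IsSpectralFilter κ a b c φ K)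
    {n : ℕ} {z : Fin n → H × ℝ} (hz : ∀ i, ‖(z i).1‖ ≤ κ) {W : ℕ → H}
    (hW : IsMomentumScheme a b c (empGrad z) W) (h0 : W 0 = 0) (v : H) {t : ℕ} (ht : 1 ≤ t) :
    (1 / (n : ℝ)) * ∑ i, inner ℝ (W t - v) (z i).1 ^ 2 + 1 / φ t * ‖W t - v‖ ^ 2 ≤
      K * (‖v‖ ^ 2 / φ t + φ t * ‖empGrad z v‖ ^ 2) := by
  let V := Submodule.span ℝ (insert v (Set.range fun i => (z i).1))
  have hfin : (insert v (Set.range fun i => (z i).1)).Finite := (Set.finite_range _).insert _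
  have : FiniteDimensional ℝ V := FiniteDimensional.span_of_finite ℝ hfin
  have hzV : ∀ i, (z i).1 ∈ V := fun i => Submodule.subset_span (Or.inr ⟨i, rfl⟩)
  have hvV : v ∈ V := Submodule.subset_span (Or.inl rfl)
  obtain ⟨d, e, σ, he, hσ, hpars⟩ := exists_empCov_eigenvectors (fun i => (z i).1) V hzV
  have hWV : ∀ t, W t ∈ V := hW.mem h0 hzV
  have hGV : empGrad z v ∈ V := V.smul_mem _ (V.sum_mem fun i _ => V.smul_mem _ (hzV i))
  have hnorm : ∀ u ∈ V, ‖u‖ ^ 2 = ∑ j, inner ℝ (e j) u ^ 2 := fun u hu => by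
    rw [← real_inner_self_eq_norm_sq, hpars u hu u hu]
    simp [sq]
  have hσe : ∀ j, σ j = (1 / (n : ℝ)) * ∑ i, inner ℝ (e j) (z i).1 ^ 2 := fun j => by
    have := hσ j (e j)
    rw [real_inner_self_eq_norm_sq, he] at this
    simp only [sq]
    linarith
  have hσ0 : ∀ j, 0 ≤ σ j := fun j => by rw [hσe]; positivity
  have hσκ : ∀ j, σ j ≤ κ ^ 2 := fun j => by
    rw [hσe]
    have h1 : ∑ i, inner ℝ (e j) (z i).1 ^ 2 ≤ ∑ _i : Fin n, κ ^ 2 :=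
      Finset.sum_le_sum fun i _ => by
        rw [← sq_abs]
        have := abs_real_inner_le_norm (e j) (z i).1
        rw [he, one_mul] at this
        exact pow_le_pow_left₀ (abs_nonneg _) (this.trans (hz i)) 2
    rw [Finset.sum_const, Finset.card_univ, Fintype.card_fin, nsmul_eq_mul] at h1
    rcases Nat.eq_zero_or_pos n with rfl | hn
    · simp [sq_nonneg]
    · have : (0 : ℝ) < n := by exact_mod_cast hn
      rw [one_div, inv_mul_le_iff₀ this]
      exact h1
  have hemp : (1 / (n : ℝ)) * ∑ i, inner ℝ (W t - v) (z i).1 ^ 2 =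
      ∑ j, σ j * inner ℝ (e j) (W t - v) ^ 2 := by
    have hu : W t - v ∈ V := V.sub_mem (hWV t) hvV
    have h2 : ∀ i, inner ℝ (W t - v) (z i).1 =
        ∑ j, inner ℝ (e j) (W t - v) * inner ℝ (e j) (z i).1 := fun i => hpars _ hu _ (hzV i)
    have h3 : ∀ j, σ j * inner ℝ (e j) (W t - v) ^ 2 = ∑ i, (1 / (n : ℝ)) *
        (inner ℝ (W t - v) (z i).1 * (inner ℝ (e j) (W t - v) * inner ℝ (e j) (z i).1)) :=
      fun j => by
        rw [sq, ← mul_assoc, ← hσ j, Finset.mul_sum, Finset.sum_mul]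
        refine Finset.sum_congr rfl fun i _ => by ring
    simp_rw [h3]
    rw [Finset.sum_comm, Finset.mul_sum]
    refine Finset.sum_congr rfl fun i _ => ?_
    rw [← Finset.mul_sum, ← Finset.mul_sum, ← h2, sq]
  have hscheme : ∀ j, IsMomentumScheme a b c
      (fun u => σ j * u - -inner ℝ (e j) (empGrad z v)) (fun t => inner ℝ (e j) (W t - v)) := by
    intro j
    have hG : ∀ w, inner ℝ (e j) (empGrad z w) =
        σ j * inner ℝ (e j) (w - v) + inner ℝ (e j) (empGrad z v) := fun w => by
      rw [← hσ j (w - v), inner_empGrad, inner_empGrad, ← mul_add, ← Finset.sum_add_distrib]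
      congr 1
      refine Finset.sum_congr rfl fun i _ => ?_
      rw [inner_sub_left]; ring
    generalize inner ℝ (e j) (empGrad z v) = η at hG ⊢
    constructor
    · beta_reduce
      rw [hW.1]
      simp only [inner_sub_right, inner_smul_right, hG, smul_eq_mul]
      ring
    · intro t
      beta_reduce
      rw [hW.2]
      simp only [inner_sub_right, inner_add_right, inner_smul_right, hG, smul_eq_mul]
      ring
  rw [hemp, hnorm _ (V.sub_mem (hWV t) hvV), hnorm v hvV, hnorm _ hGV, Finset.mul_sum,
    ← Finset.sum_add_distrib, Finset.sum_div, Finset.mul_sum, ← Finset.sum_add_distrib,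
    Finset.mul_sum]
  refine Finset.sum_le_sum fun j _ => ?_
  have := hf (σ j) _ _ (hσ0 j) (hσκ j) (hscheme j) t ht
  simp only [h0, zero_sub, inner_neg_right, neg_sq] at this
  linarith

section Methods

variable {n : ℕ} (z : Fin n → H × ℝ)

lemma isMomentumScheme_gradientDescent (α : ℝ) :
    IsMomentumScheme (fun _ => α) 0 0 (empGrad z) (gradientDescent α n z) := by
  constructor
  · rfl
  · intro t
    simp only [Pi.zero_apply, zero_smul, add_zero]
    rfl

lemma isMomentumScheme_heavyBall (κ ν : ℝ) :
    IsMomentumScheme (fun t => heavyBallStep κ ν (t + 1)) (fun t => heavyBallMomentum ν (t + 2)) 0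
      (empGrad z) (heavyBall κ ν n z) := by
  constructor
  · simp [heavyBall, heavyBallState]
  · intro t
    simp only [Pi.zero_apply, zero_smul, add_zero, heavyBall, heavyBallState]
    abel

lemma isMomentumScheme_nesterov (α β : ℝ) :
    IsMomentumScheme (fun _ => α) (fun t => (t : ℝ) / (t + 1 + β))
      (fun t => (t : ℝ) / (t + 1 + β)) (empGrad z) (nesterov α β n z) := by
  constructor
  · simp [nesterov, nesterovState]
  · intro t
    simp [nesterov, nesterovState]

end Methods

/-- `w` is, on every sample, a momentum scheme started at `0` whose coefficients form a spectral
filter with regularization parameter `1 / φ t`. -/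
def IsSpectralMethod (κ : ℝ) (φ : ℕ → ℝ) (w : Method H) : Prop :=
  ∃ (a b c : ℕ → ℝ) (K : ℝ), 0 < K ∧ IsSpectralFilter κ a b c φ K ∧
    ∀ (n : ℕ) (z : Fin n → H × ℝ), w n z 0 = 0 ∧ IsMomentumScheme a b c (empGrad z) (w n z)

lemma IsGradientDescent.isSpectralMethod {κ : ℝ} (hκ : 0 < κ) {w : Method H}
    (hw : IsGradientDescent κ w) : IsSpectralMethod κ (fun t => (t : ℝ)) w := by
  obtain ⟨α, hα, hακ, rfl⟩ := hw
  obtain ⟨K, hK, hf⟩ := isSpectralFilter_gradientDescent hα ((lt_div_iff₀ (by positivity)).1 hακ)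
  exact ⟨_, _, _, K, hK, hf, fun n z => ⟨rfl, isMomentumScheme_gradientDescent z α⟩⟩

lemma IsAccelerated.isSpectralMethod {κ : ℝ} (hκ : 0 < κ) {w : Method H}
    (hw : IsAccelerated κ w) : IsSpectralMethod κ (fun t => (t : ℝ) ^ 2) w := by
  obtain ⟨ν, hν, rfl⟩ | ⟨α, β, hα, hακ, hβ, rfl⟩ := hw
  · obtain ⟨K, hK, hf⟩ := isSpectralFilter_heavyBall hκ hν
    exact ⟨_, _, _, K, hK, hf, fun n z => ⟨rfl, isMomentumScheme_heavyBall z κ ν⟩⟩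
  · obtain ⟨K, hK, hf⟩ :=
      isSpectralFilter_nesterov hα ((lt_div_iff₀ (by positivity)).1 hακ) hβ
    exact ⟨_, _, _, K, hK, hf, fun n z => ⟨rfl, isMomentumScheme_nesterov z α β⟩⟩

/-! ### Sums of independent centred vectors in a Hilbert space -/

/-- Iterated one-step bounds for a sum of independent terms: if averaging over one term turns
`F (k + 1)` into something at most `F k`, on a set `D` of states that the sums do not leave, then
`F n`, averaged over `n` terms, is at most `F 0`. -/
lemma lintegral_sum_le {Ω E : Type*} [MeasurableSpace Ω] (μ : Measure Ω) [IsProbabilityMeasure μ]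
    [AddCommMonoid E] (y : Ω → E) (D : Set E) (hD : ∀ S ∈ D, ∀ ω, S + y ω ∈ D)
    (F : ℕ → E → ENNReal)
    (hF : ∀ (m k : ℕ) (S : E), Measurable fun z : Fin m → Ω => F k (S + ∑ i, y (z i)))
    (n k : ℕ)
    (hstep : ∀ j, k ≤ j → j < k + n → ∀ S ∈ D, ∫⁻ ω, F (j + 1) (S + y ω) ∂μ ≤ F j S)
    (S : E) (hS : S ∈ D) :
    ∫⁻ z, F (k + n) (S + ∑ i, y (z i)) ∂(Measure.pi fun _ : Fin n => μ) ≤ F k S := by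
  induction n generalizing k S with
  | zero => simp
  | succ n ih =>
    have hmp := measurePreserving_piFinSuccAbove (fun _ : Fin (n + 1) => μ) 0
    have h1 : ∫⁻ z, F (k + (n + 1)) (S + ∑ i, y (z i)) ∂(Measure.pi fun _ : Fin (n + 1) => μ) =
        ∫⁻ p : Ω × (Fin n → Ω), F (k + 1 + n) (S + y p.1 + ∑ i, y (p.2 i))
          ∂(μ.prod (Measure.pi fun _ : Fin n => μ)) := by
      rw [← hmp.lintegral_comp_emb (MeasurableEquiv.measurableEmbedding _)]
      refine lintegral_congr fun z => ?_
      rw [Fin.sum_univ_succ, show k + (n + 1) = k + 1 + n by ring, add_assoc]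
      simp [MeasurableEquiv.piFinSuccAbove_apply, Fin.tail, add_assoc]
    have hmeas : Measurable fun p : Ω × (Fin n → Ω) =>
        F (k + 1 + n) (S + y p.1 + ∑ i, y (p.2 i)) := by
      have := (hF (n + 1) (k + 1 + n) S).comp
        (MeasurableEquiv.piFinSuccAbove (fun _ : Fin (n + 1) => Ω) 0).symm.measurable
      convert this using 1
      funext p
      simp only [Function.comp, MeasurableEquiv.piFinSuccAbove_symm_apply, Fin.insertNthEquiv_zero,
        Fin.consEquiv_apply, Fin.sum_univ_succ, Fin.cons_zero, Fin.cons_succ, add_assoc]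
    rw [h1, lintegral_prod _ hmeas.aemeasurable]
    calc _ ≤ ∫⁻ ω, F (k + 1) (S + y ω) ∂μ := by
          refine lintegral_mono fun ω => ?_
          exact ih (k + 1) (fun j hj hj' => hstep j (by omega) (by omega)) _ (hD S hS ω)
      _ ≤ F k S := hstep k le_rfl (by omega) S hS

/-- The function `s ↦ cosh √s` is convex on `[0, ∞)`, all coefficients of its power series being
nonnegative; the right-hand side is its chord between `(a - B)²` and `(a + B)²`. -/
lemma cosh_sqrt_le_chord {a B c : ℝ} (ha : 0 < a) (hB : 0 < B) (hc : |c| ≤ a * B) :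
    Real.cosh (√(a ^ 2 + 2 * c + B ^ 2)) ≤
      Real.cosh a * Real.cosh B + c * (Real.sinh a / a * (Real.sinh B / B)) := by
  have hs : ∀ s : ℝ, 0 ≤ s → HasSum (fun k : ℕ => s ^ k / ((2 * k).factorial : ℝ))
      (Real.cosh (√s)) := fun s hs => by
    have := Real.hasSum_cosh (√s)
    simpa only [pow_mul, Real.sq_sqrt hs] using this
  obtain ⟨hc1, hc2⟩ := abs_le.1 hc
  have hab : 0 < a * B := mul_pos ha hB
  set p := (1 + c / (a * B)) / 2 with hp
  have hp0 : 0 ≤ p := by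
    have : -1 ≤ c / (a * B) := by rw [le_div_iff₀ hab]; linarith
    rw [hp]; linarith
  have hp1 : 0 ≤ 1 - p := by
    have : c / (a * B) ≤ 1 := by rw [div_le_iff₀ hab]; linarith
    rw [hp]; linarith
  have hcp : c = (2 * p - 1) * (a * B) := by rw [hp]; field_simp; ring
  have hmid : a ^ 2 + 2 * c + B ^ 2 = p * (a + B) ^ 2 + (1 - p) * (a - B) ^ 2 := by
    rw [hcp]; ring
  have h1 := (hs _ (sq_nonneg (a + B))).mul_left p
  have h2 := (hs _ (sq_nonneg (a - B))).mul_left (1 - p)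
  have hle := hasSum_le (fun k => ?_) (hs (a ^ 2 + 2 * c + B ^ 2)
    (by rw [hmid]; positivity)) (h1.add h2)
  · refine hle.trans (le_of_eq ?_)
    rw [Real.sqrt_sq_eq_abs, Real.sqrt_sq_eq_abs, Real.cosh_abs, Real.cosh_abs, Real.cosh_add,
      Real.cosh_sub, hcp]
    field_simp
    ring
  · have := (convexOn_pow k).2 (Set.mem_Ici.2 (sq_nonneg (a + B)))
      (Set.mem_Ici.2 (sq_nonneg (a - B))) hp0 hp1 (by ring)
    simp only [smul_eq_mul] at this
    rw [hmid, ← mul_div_assoc, ← mul_div_assoc, ← add_div]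
    gcongr

lemma cosh_norm_add_le {B : ℝ} (hB : 0 < B) (S ξ : H) (hξ : ‖ξ‖ ≤ B) :
    Real.cosh ‖S + ξ‖ ≤ Real.cosh ‖S‖ * Real.cosh B +
      inner ℝ S ξ * (Real.sinh ‖S‖ / ‖S‖ * (Real.sinh B / B)) := by
  rcases eq_or_ne S 0 with rfl | hS
  · simpa [abs_of_pos hB] using hξ
  · have h1 : ‖S + ξ‖ ≤ √(‖S‖ ^ 2 + 2 * inner ℝ S ξ + B ^ 2) := by
      apply Real.le_sqrt_of_sq_le
      rw [norm_add_sq_real]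
      gcongr
    refine (Real.cosh_le_cosh.2 ?_).trans (cosh_sqrt_le_chord (norm_pos_iff.2 hS) hB
      ((abs_real_inner_le_norm S ξ).trans (by gcongr)))
    rw [abs_of_nonneg (norm_nonneg _), abs_of_nonneg (Real.sqrt_nonneg _)]
    exact h1

/-- One step of the exponential bound for sums of centred Hilbert-space valued variables. -/
lemma lintegral_cosh_norm_add_le {Ω : Type*} [MeasurableSpace Ω] (μ : Measure Ω)
    [IsProbabilityMeasure μ] {ξ : Ω → H} {B : ℝ} (hB : 0 < B)
    (hξB : ∀ᵐ ω ∂μ, ‖ξ ω‖ ≤ B) (hint : ∀ v, Integrable (fun ω => inner ℝ v (ξ ω)) μ)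
    (hmean : ∀ v, ∫ ω, inner ℝ v (ξ ω) ∂μ = 0) (S : H) :
    ∫⁻ ω, ENNReal.ofReal (Real.cosh ‖S + ξ ω‖) ∂μ ≤
      ENNReal.ofReal (Real.cosh ‖S‖ * Real.cosh B) := by
  set g := Real.sinh ‖S‖ / ‖S‖ * (Real.sinh B / B)
  have hI : Integrable (fun ω => Real.cosh ‖S‖ * Real.cosh B + inner ℝ S (ξ ω) * g) μ :=
    (integrable_const _).add ((hint S).mul_const g)
  have hle : ∀ᵐ ω ∂μ, Real.cosh ‖S + ξ ω‖ ≤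
      Real.cosh ‖S‖ * Real.cosh B + inner ℝ S (ξ ω) * g := by
    filter_upwards [hξB] with ω hω using cosh_norm_add_le hB S (ξ ω) hω
  calc _ ≤ ∫⁻ ω, ENNReal.ofReal (Real.cosh ‖S‖ * Real.cosh B + inner ℝ S (ξ ω) * g) ∂μ :=
        lintegral_mono_ae (by filter_upwards [hle] with ω hω using ENNReal.ofReal_le_ofReal hω)
    _ = ENNReal.ofReal (∫ ω, Real.cosh ‖S‖ * Real.cosh B + inner ℝ S (ξ ω) * g ∂μ) := by
        rw [ofReal_integral_eq_lintegral_ofReal hI]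
        filter_upwards [hle] with ω hω using (Real.cosh_pos _).le.trans hω
    _ = _ := by
        rw [integral_add (integrable_const _) ((hint S).mul_const g), integral_mul_const _ (fun ω => inner ℝ S (ξ ω)), hmean]
        simp

/-- A Hoeffding-type inequality in Hilbert space: the norm of a sum of `n` independent centred
variables of norm at most `B` exceeds `B √n (L + 1/2)` with probability at most `2 exp (-L)`. -/
lemma measure_norm_sum_ge_le {Ω : Type*} [MeasurableSpace Ω] (μ : Measure Ω)
    [IsProbabilityMeasure μ] [MeasurableSpace H] [BorelSpace H] [SecondCountableTopology H]
    {ξ : Ω → H} (hξ : Measurable ξ) {B : ℝ} (hB : 0 < B)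
    (hξB : ∀ᵐ ω ∂μ, ‖ξ ω‖ ≤ B) (hmean : ∀ v, ∫ ω, inner ℝ v (ξ ω) ∂μ = 0) {n : ℕ} (hn : 0 < n)
    (L : ℝ) :
    (Measure.pi fun _ : Fin n => μ) {z | B * √n * (L + 1 / 2) ≤ ‖∑ i, ξ (z i)‖} ≤
      ENNReal.ofReal (2 * Real.exp (-L)) := by
  have hn' : (0 : ℝ) < √n := Real.sqrt_pos.2 (by exact_mod_cast hn)
  set θ := 1 / (B * √n) with hθ
  have hθ0 : 0 < θ := by positivity
  set q := Real.cosh (θ * B) with hq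
  have hq0 : 0 < q := Real.cosh_pos _
  have hbound : ∀ᵐ ω ∂μ, ‖θ • ξ ω‖ ≤ θ * B := by
    filter_upwards [hξB] with ω hω
    rw [norm_smul, Real.norm_of_nonneg hθ0.le]
    gcongr
  have hint : ∀ v, Integrable (fun ω => inner ℝ v (θ • ξ ω)) μ := fun v => by
    refine Integrable.of_bound (C := ‖v‖ * (θ * B)) ?_ ?_
    · exact (measurable_const.inner (hξ.const_smul θ)).aestronglyMeasurable
    · filter_upwards [hbound] with ω hω
      exact (norm_inner_le_norm _ _).trans (by gcongr)
  have hmean' : ∀ v, ∫ ω, inner ℝ v (θ • ξ ω) ∂μ = 0 := fun v => by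
    simp only [inner_smul_right, integral_const_mul, hmean, mul_zero]
  have key := lintegral_sum_le μ (fun ω => θ • ξ ω) Set.univ (fun _ _ _ => Set.mem_univ _)
    (fun k S => ENNReal.ofReal (Real.cosh ‖S‖ * q ^ (n - k)))
    (fun m k S => by
      apply ENNReal.measurable_ofReal.comp
      refine Measurable.mul_const ?_ _
      refine Real.continuous_cosh.measurable.comp (Measurable.norm ?_)
      exact measurable_const.add (Finset.measurable_sum _ fun i _ =>
        (hξ.comp (measurable_pi_apply i)).const_smul θ))
    n 0 (fun j _ hj S _ => by
      have h1 : n - j = (n - (j + 1)) + 1 := by omega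
      have h2 := lintegral_cosh_norm_add_le μ (by positivity : 0 < θ * B) hbound hint hmean' S
      rw [h1]
      calc _ = ∫⁻ ω, ENNReal.ofReal (Real.cosh ‖S + θ • ξ ω‖) *
            ENNReal.ofReal (q ^ (n - (j + 1))) ∂μ := by
            refine lintegral_congr fun ω => ?_
            rw [ENNReal.ofReal_mul (Real.cosh_pos _).le]
        _ = (∫⁻ ω, ENNReal.ofReal (Real.cosh ‖S + θ • ξ ω‖) ∂μ) *
            ENNReal.ofReal (q ^ (n - (j + 1))) := by
            rw [lintegral_mul_const']
            exact ENNReal.ofReal_ne_top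
        _ ≤ ENNReal.ofReal (Real.cosh ‖S‖ * q) * ENNReal.ofReal (q ^ (n - (j + 1))) := by
            gcongr
        _ = _ := by
            rw [← ENNReal.ofReal_mul (mul_nonneg (Real.cosh_pos _).le hq0.le)]
            ring_nf)
    0 (Set.mem_univ _)
  simp only [zero_add, Nat.sub_self, pow_zero, mul_one, norm_zero, Real.cosh_zero, one_mul,
    Nat.sub_zero, ← Finset.smul_sum, norm_smul, Real.norm_of_nonneg hθ0.le] at key
  have hqn : q ^ n ≤ Real.exp (1 / 2) := by
    have h1 : q ≤ Real.exp ((θ * B) ^ 2 / 2) := Real.cosh_le_exp_half_sq _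
    have h2 : (θ * B) ^ 2 = 1 / n := by
      rw [hθ]
      field_simp
      rw [Real.sq_sqrt (Nat.cast_nonneg n)]
    calc q ^ n ≤ Real.exp ((θ * B) ^ 2 / 2) ^ n := by gcongr
      _ = Real.exp (1 / 2) := by
        rw [← Real.exp_nat_mul, h2]
        congr 1
        have : (n : ℝ) ≠ 0 := by positivity
        field_simp
  have hsub : {z : Fin n → Ω | B * √n * (L + 1 / 2) ≤ ‖∑ i, ξ (z i)‖} ⊆
      {z | ENNReal.ofReal (Real.exp (L + 1 / 2) / 2) ≤
        ENNReal.ofReal (Real.cosh (θ * ‖∑ i, ξ (z i)‖))} := fun z hz => by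
    apply ENNReal.ofReal_le_ofReal
    have h1 : L + 1 / 2 ≤ θ * ‖∑ i, ξ (z i)‖ := by
      rw [hθ, one_div_mul_eq_div, le_div_iff₀ (by positivity)]
      linarith [show B * √n * (L + 1 / 2) ≤ ‖∑ i, ξ (z i)‖ from hz]
    have h2 := Real.exp_le_exp.2 h1
    rw [Real.cosh_eq]
    linarith [Real.exp_pos (-(θ * ‖∑ i, ξ (z i)‖))]
  refine (measure_mono hsub).trans ?_
  have hpos : 0 < Real.exp (L + 1 / 2) / 2 := by positivity
  refine (meas_ge_le_lintegral_div ?_ (by simpa using hpos) ENNReal.ofReal_ne_top).trans ?_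
  · refine (ENNReal.measurable_ofReal.comp (Real.continuous_cosh.measurable.comp
      (Measurable.const_mul (Measurable.norm ?_) θ))).aemeasurable
    exact Finset.measurable_sum _ fun i _ => hξ.comp (measurable_pi_apply i)
  · calc _ ≤ ENNReal.ofReal (Real.exp (1 / 2)) / ENNReal.ofReal (Real.exp (L + 1 / 2) / 2) := by
          gcongr
          exact key.trans (ENNReal.ofReal_le_ofReal hqn)
      _ = ENNReal.ofReal (Real.exp (1 / 2) / (Real.exp (L + 1 / 2) / 2)) := by
          rw [ENNReal.ofReal_div_of_pos hpos]
      _ = _ := by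
          congr 1
          rw [Real.exp_add, Real.exp_neg]
          field_simp

/-! ### Trace inequalities for powers of the inverse matrix -/

section MatrixTrace
open Matrix

variable {d : Type*} [Fintype d]

lemma posDef_add_vecMulVec {N : Matrix d d ℝ} (hN : N.PosDef) (x : d → ℝ) :
    (N + vecMulVec x x).PosDef := by
  refine hN.add_posSemidef ?_
  simpa using posSemidef_vecMulVec_self_star x

/-- Chebyshev's sum inequality for the moments `a_k = ∑ᵢ wᵢ sᵢᵏ`: `a_{i+1} a_{m-i} ≤ a_1 a_m`. -/
lemma moment_mul_moment_le {w s : d → ℝ} (hw : ∀ i, 0 ≤ w i) (hs : ∀ i, 0 ≤ s i) {m i : ℕ}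
    (hi : i < m) :
    (∑ j, w j * s j ^ (i + 1)) * (∑ j, w j * s j ^ (m - i)) ≤
      (∑ j, w j * s j ^ 1) * ∑ j, w j * s j ^ m := by
  obtain ⟨q, rfl⟩ : ∃ q, m = i + q + 1 := ⟨m - i - 1, by omega⟩
  rw [show i + q + 1 - i = q + 1 by omega]
  have key : 0 ≤ ∑ j, ∑ k, w j * w k * (s j * s k * ((s j ^ i - s k ^ i) * (s j ^ q - s k ^ q))) := by
    refine Finset.sum_nonneg fun j _ => Finset.sum_nonneg fun k _ => ?_
    refine mul_nonneg (mul_nonneg (hw j) (hw k)) (mul_nonneg (mul_nonneg (hs j) (hs k)) ?_)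
    rcases le_total (s j) (s k) with h | h
    · exact mul_nonneg_of_nonpos_of_nonpos (sub_nonpos.2 (pow_le_pow_left₀ (hs j) h _))
        (sub_nonpos.2 (pow_le_pow_left₀ (hs j) h _))
    · exact mul_nonneg (sub_nonneg.2 (pow_le_pow_left₀ (hs k) h _))
        (sub_nonneg.2 (pow_le_pow_left₀ (hs k) h _))
  have expand : ∑ j, ∑ k, w j * w k * (s j * s k * ((s j ^ i - s k ^ i) * (s j ^ q - s k ^ q))) =
      2 * ((∑ j, w j * s j ^ 1) * ∑ j, w j * s j ^ (i + q + 1)) -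
      2 * ((∑ j, w j * s j ^ (i + 1)) * (∑ j, w j * s j ^ (q + 1))) := by
    have e : ∀ f g : d → ℝ, (∑ j, f j) * (∑ k, g k) = ∑ j, ∑ k, f j * g k := fun f g =>
      Finset.sum_mul_sum _ _ _ _
    have e' : ∀ f g : d → ℝ, (∑ j, f j) * (∑ k, g k) = ∑ j, ∑ k, f k * g j := fun f g => by
      rw [e, Finset.sum_comm]
    rw [two_mul, two_mul]
    nth_rewrite 1 [e]
    nth_rewrite 1 [e']
    nth_rewrite 1 [e]
    nth_rewrite 1 [e']
    simp only [← Finset.sum_add_distrib, ← Finset.sum_sub_distrib]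
    refine Finset.sum_congr rfl fun j _ => Finset.sum_congr rfl fun k _ => ?_
    ring
  linarith

variable [DecidableEq d]

/-- Orthogonal diagonalization of a positive definite matrix and of the powers of its inverse. -/
lemma _root_.Matrix.PosDef.exists_diagonalization {N : Matrix d d ℝ} (hN : N.PosDef) :
    ∃ (U : Matrix d d ℝ) (a : d → ℝ), U * Uᵀ = 1 ∧ Uᵀ * U = 1 ∧ (∀ i, 0 < a i) ∧
      N = U * diagonal a * Uᵀ ∧ ∀ k, N⁻¹ ^ k = U * diagonal (fun i => (a i)⁻¹ ^ k) * Uᵀ := by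
  set U : Matrix d d ℝ := (hN.1.eigenvectorUnitary : Matrix d d ℝ)
  have hU : star U = Uᵀ := by ext; simp [star_apply]
  have h1 : U * Uᵀ = 1 := by rw [← hU]; exact Unitary.coe_mul_star_self _
  have h2 : Uᵀ * U = 1 := by rw [← hU]; exact Unitary.coe_star_mul_self _
  have hpos : ∀ i, 0 < hN.1.eigenvalues i := hN.eigenvalues_pos
  have hsp : N = U * diagonal hN.1.eigenvalues * Uᵀ := by
    have h3 := hN.1.spectral_theorem
    rw [Unitary.conjStarAlgAut_apply] at h3
    rw [← hU]
    exact h3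
  have hinv : N⁻¹ = U * diagonal (fun i => (hN.1.eigenvalues i)⁻¹) * Uᵀ := by
    apply inv_eq_right_inv
    nth_rewrite 1 [hsp]
    calc U * diagonal hN.1.eigenvalues * Uᵀ *
          (U * diagonal (fun i => (hN.1.eigenvalues i)⁻¹) * Uᵀ) =
        U * (diagonal hN.1.eigenvalues * (Uᵀ * U) *
          diagonal (fun i => (hN.1.eigenvalues i)⁻¹)) * Uᵀ := by simp only [Matrix.mul_assoc]
      _ = 1 := by
        rw [h2, Matrix.mul_one, diagonal_mul_diagonal]
        simp [fun i => mul_inv_cancel₀ (hpos i).ne', h1]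
  refine ⟨U, hN.1.eigenvalues, h1, h2, hpos, hsp, fun k => ?_⟩
  induction k with
  | zero => simp [h1]
  | succ k ih =>
    rw [pow_succ, ih, hinv]
    calc U * diagonal (fun i => (hN.1.eigenvalues i)⁻¹ ^ k) * Uᵀ *
          (U * diagonal (fun i => (hN.1.eigenvalues i)⁻¹) * Uᵀ) =
        U * (diagonal (fun i => (hN.1.eigenvalues i)⁻¹ ^ k) * (Uᵀ * U) *
          diagonal (fun i => (hN.1.eigenvalues i)⁻¹)) * Uᵀ := by simp only [Matrix.mul_assoc]
      _ = _ := by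
        rw [h2, Matrix.mul_one, diagonal_mul_diagonal]
        simp [pow_succ]

lemma trace_conj_diagonal {U : Matrix d d ℝ} (hU : Uᵀ * U = 1) (f : d → ℝ) :
    trace (U * diagonal f * Uᵀ) = ∑ i, f i := by
  rw [Matrix.mul_assoc, trace_mul_comm, Matrix.mul_assoc, hU, Matrix.mul_one, trace_diagonal]

lemma dotProduct_conj_diagonal_mulVec (U : Matrix d d ℝ) (f : d → ℝ) (x : d → ℝ) :
    x ⬝ᵥ ((U * diagonal f * Uᵀ) *ᵥ x) = ∑ i, (Uᵀ *ᵥ x) i ^ 2 * f i := by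
  rw [← mulVec_mulVec, ← mulVec_mulVec, dotProduct_mulVec, ← mulVec_transpose]
  simp only [dotProduct, mulVec_diagonal]
  exact Finset.sum_congr rfl fun i _ => by ring

lemma trace_conj_diagonal_mul (U W : Matrix d d ℝ) (f g : d → ℝ) :
    trace (W * diagonal f * Wᵀ * (U * diagonal g * Uᵀ)) =
      ∑ i, ∑ j, (Uᵀ * W) i j ^ 2 * (f j * g i) := by
  have h1 : trace (W * diagonal f * Wᵀ * (U * diagonal g * Uᵀ)) =
      trace (Uᵀ * W * diagonal f * ((Uᵀ * W)ᵀ * diagonal g)) := by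
    rw [transpose_mul, transpose_transpose, ← Matrix.mul_assoc, trace_mul_comm]
    simp only [Matrix.mul_assoc]
  rw [h1, trace]
  refine Finset.sum_congr rfl fun i _ => ?_
  rw [diag_apply, mul_apply]
  refine Finset.sum_congr rfl fun j _ => ?_
  rw [mul_diagonal, mul_diagonal, transpose_apply]
  ring

/-- The tangent inequality for the convex function `a ↦ a⁻ᵖ` on `(0, ∞)`. -/
lemma inv_pow_tangent_le {a b : ℝ} (ha : 0 < a) (hb : 0 < b) (p : ℕ) :
    p * (b⁻¹ ^ p - b⁻¹ ^ (p + 1) * a) ≤ a⁻¹ ^ p - b⁻¹ ^ p := by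
  have h1 : 1 + p * (b / a - 1) ≤ (b / a) ^ p := by
    have := one_add_mul_le_pow (a := b / a - 1) (by have := div_pos hb ha; linarith) p
    simpa using this
  have h2 : 1 - a / b ≤ b / a - 1 := by
    have : a / b + b / a - 2 = (a - b) ^ 2 / (a * b) := by field_simp; ring
    have : 0 ≤ (a - b) ^ 2 / (a * b) := by positivity
    linarith
  have h3 : p * (1 - a / b) ≤ (b / a) ^ p - 1 := by
    have := mul_le_mul_of_nonneg_left h2 (Nat.cast_nonneg (α := ℝ) p)
    linarith
  have h4 := mul_le_mul_of_nonneg_left h3 (by positivity : 0 ≤ b⁻¹ ^ p)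
  have h5 : b⁻¹ ^ p * (b / a) ^ p = a⁻¹ ^ p := by
    rw [← mul_pow]
    congr 1
    field_simp
  calc p * (b⁻¹ ^ p - b⁻¹ ^ (p + 1) * a) = b⁻¹ ^ p * (p * (1 - a / b)) := by
        rw [pow_succ]; field_simp
    _ ≤ b⁻¹ ^ p * ((b / a) ^ p - 1) := h4
    _ = _ := by rw [mul_sub, h5, mul_one]

/-- Klein's inequality for `A ↦ tr A⁻ᵖ`: the tangent inequality of a convex trace function. -/
lemma klein_trace_inv_pow {A B : Matrix d d ℝ} (hA : A.PosDef) (hB : B.PosDef) (p : ℕ) :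
    p * (trace (B⁻¹ ^ p) - trace (B⁻¹ ^ (p + 1) * A)) ≤ trace (A⁻¹ ^ p) - trace (B⁻¹ ^ p) := by
  obtain ⟨U, a, hU1, hU2, ha, hAe, hAp⟩ := hA.exists_diagonalization
  obtain ⟨W, b, hW1, hW2, hb, hBe, hBp⟩ := hB.exists_diagonalization
  rw [hBp (p + 1), hAe, trace_conj_diagonal_mul, ← hAe, hAp, hBp, trace_conj_diagonal hU2,
    trace_conj_diagonal hW2]
  set O := Uᵀ * W with hO
  have hO1 : O * Oᵀ = 1 := by
    rw [hO, transpose_mul, transpose_transpose, Matrix.mul_assoc, ← Matrix.mul_assoc W, hW1,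
      Matrix.one_mul, hU2]
  have hO2 : Oᵀ * O = 1 := by
    rw [hO, transpose_mul, transpose_transpose, Matrix.mul_assoc, ← Matrix.mul_assoc U, hU1,
      Matrix.one_mul, hW2]
  have hrow : ∀ i, ∑ j, O i j ^ 2 = 1 := fun i => by
    have := congrFun (congrFun hO1 i) i
    rw [mul_apply, one_apply_eq] at this
    simpa [sq] using this
  have hcol : ∀ j, ∑ i, O i j ^ 2 = 1 := fun j => by
    have := congrFun (congrFun hO2 j) j
    rw [mul_apply, one_apply_eq] at this
    simpa [sq] using this
  have e1 : ∑ i, (a i)⁻¹ ^ p = ∑ i, ∑ j, O i j ^ 2 * (a i)⁻¹ ^ p :=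
    Finset.sum_congr rfl fun i _ => by rw [← Finset.sum_mul, hrow, one_mul]
  have e2 : ∑ j, (b j)⁻¹ ^ p = ∑ i, ∑ j, O i j ^ 2 * (b j)⁻¹ ^ p := by
    rw [Finset.sum_comm]
    exact Finset.sum_congr rfl fun j _ => by rw [← Finset.sum_mul, hcol, one_mul]
  rw [e1, e2, ← Finset.sum_sub_distrib, ← Finset.sum_sub_distrib, Finset.mul_sum]
  refine Finset.sum_le_sum fun i _ => ?_
  rw [← Finset.sum_sub_distrib, ← Finset.sum_sub_distrib, Finset.mul_sum]
  refine Finset.sum_le_sum fun j _ => ?_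
  have := mul_le_mul_of_nonneg_left (inv_pow_tangent_le (ha i) (hb j) p) (sq_nonneg (O i j))
  linarith

lemma isUnit_det_of_posDef {N : Matrix d d ℝ} (hN : N.PosDef) : IsUnit N.det :=
  (isUnit_iff_isUnit_det _).1 hN.isUnit

/-- The telescoped resolvent identity for a rank-one perturbation. -/
lemma inv_pow_sub_inv_pow_add_vecMulVec {N : Matrix d d ℝ} (hN : N.PosDef) (x : d → ℝ) (m : ℕ) :
    N⁻¹ ^ m - (N + vecMulVec x x)⁻¹ ^ m = ∑ j ∈ Finset.range m,
      (N + vecMulVec x x)⁻¹ ^ (j + 1) * vecMulVec x x * N⁻¹ ^ (m - j) := by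
  set N' := N + vecMulVec x x with hN'
  have h1 : N⁻¹ - N'⁻¹ = N'⁻¹ * vecMulVec x x * N⁻¹ := by
    have hu := isUnit_det_of_posDef hN
    have hu' := isUnit_det_of_posDef (posDef_add_vecMulVec hN x)
    have : vecMulVec x x = N' - N := by rw [hN']; abel
    rw [this, Matrix.mul_sub, Matrix.sub_mul, nonsing_inv_mul _ hu', Matrix.one_mul,
      Matrix.mul_assoc, mul_nonsing_inv _ hu, Matrix.mul_one]
  induction m with
  | zero => simp
  | succ m ih =>
    rw [Finset.sum_range_succ', zero_add, pow_one, Nat.sub_zero]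
    have h2 : N⁻¹ ^ (m + 1) - N'⁻¹ ^ (m + 1) =
        N'⁻¹ * (N⁻¹ ^ m - N'⁻¹ ^ m) + (N⁻¹ - N'⁻¹) * N⁻¹ ^ m := by
      rw [pow_succ' N⁻¹, pow_succ' N'⁻¹]
      noncomm_ring
    rw [h2, ih, h1, Finset.mul_sum]
    congr 1
    · refine Finset.sum_congr rfl fun j _ => ?_
      rw [Nat.add_sub_add_right, pow_succ' N'⁻¹ (j + 1)]
      simp only [Matrix.mul_assoc]
    · rw [pow_succ' N⁻¹]
      simp only [Matrix.mul_assoc]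

lemma dotProduct_inv_mulVec_le {N : Matrix d d ℝ} (hN : N.PosDef) {h : ℝ} (hh : 0 < h)
    (hNh : ∀ v, h * (v ⬝ᵥ v) ≤ v ⬝ᵥ (N *ᵥ v)) (x : d → ℝ) :
    h * (x ⬝ᵥ (N⁻¹ *ᵥ x)) ≤ x ⬝ᵥ x := by
  set y := N⁻¹ *ᵥ x with hy
  have hNy : N *ᵥ y = x := by
    rw [hy, mulVec_mulVec, mul_nonsing_inv _ (isUnit_det_of_posDef hN), one_mulVec]
  have h1 := hNh y
  rw [hNy, dotProduct_comm y x] at h1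
  have h2 : 0 ≤ (x - h • y) ⬝ᵥ (x - h • y) := by
    simpa using dotProduct_star_self_nonneg (x - h • y)
  simp only [sub_dotProduct, dotProduct_sub, smul_dotProduct, dotProduct_smul, smul_eq_mul,
    dotProduct_comm y x] at h2
  nlinarith

/-- Adding `x xᵀ` to `N ≥ h`, with `x` short compared to `h`, lowers `tr N⁻ᵖ` by at least half of
the amount predicted by the derivative at `N`. -/
lemma trace_inv_pow_add_vecMulVec_le {N : Matrix d d ℝ} (hN : N.PosDef) {h : ℝ} (hh : 0 < h)
    (hNh : ∀ v, h * (v ⬝ᵥ v) ≤ v ⬝ᵥ (N *ᵥ v)) (x : d → ℝ) (p : ℕ)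
    (hx : 2 * (p + 1) * (x ⬝ᵥ x) ≤ h) :
    trace ((N + vecMulVec x x)⁻¹ ^ p) ≤
      trace (N⁻¹ ^ p) - p / 2 * (x ⬝ᵥ (N⁻¹ ^ (p + 1) *ᵥ x)) := by
  have hN' := posDef_add_vecMulVec hN x
  set N' := N + vecMulVec x x with hN'def
  obtain ⟨U, a, hU1, hU2, ha, hAe, hAp⟩ := hN.exists_diagonalization
  obtain ⟨W, b, hW1, hW2, hb, hBe, hBp⟩ := hN'.exists_diagonalization
  set α : ℕ → ℝ := fun k => x ⬝ᵥ (N⁻¹ ^ k *ᵥ x) with hα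
  set β : ℕ → ℝ := fun k => x ⬝ᵥ (N'⁻¹ ^ k *ᵥ x) with hβ
  have hα0 : ∀ k, 0 ≤ α k := fun k => by
    simp only [hα, hAp, dotProduct_conj_diagonal_mulVec]
    exact Finset.sum_nonneg fun i _ => mul_nonneg (sq_nonneg _) (by have := ha i; positivity)
  have hβ0 : ∀ k, 0 ≤ β k := fun k => by
    simp only [hβ, hBp, dotProduct_conj_diagonal_mulVec]
    exact Finset.sum_nonneg fun i _ => mul_nonneg (sq_nonneg _) (by have := hb i; positivity)
  have hdiff : ∀ m, α m - β m = ∑ j ∈ Finset.range m, β (j + 1) * α (m - j) := fun m => by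
    simp only [hα, hβ]
    rw [← dotProduct_sub, ← sub_mulVec, inv_pow_sub_inv_pow_add_vecMulVec hN x m, sum_mulVec,
      dotProduct_sum]
    refine Finset.sum_congr rfl fun j _ => ?_
    rw [← hN'def, ← mulVec_mulVec, ← mulVec_mulVec, vecMulVec_mulVec]
    simp [mulVec_smul, dotProduct_smul, mul_comm]
  have hβα : ∀ m, β m ≤ α m := fun m => by
    have : 0 ≤ α m - β m := by
      rw [hdiff]
      exact Finset.sum_nonneg fun j _ => mul_nonneg (hβ0 _) (hα0 _)
    linarith
  have hcheb : ∀ i < p + 1, β (i + 1) * α (p + 1 - i) ≤ α 1 * α (p + 1) := fun i hi => by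
    refine (mul_le_mul_of_nonneg_right (hβα _) (hα0 _)).trans ?_
    simp only [hα, hAp, dotProduct_conj_diagonal_mulVec]
    exact moment_mul_moment_le (fun j => sq_nonneg _) (fun j => (inv_pos.2 (ha j)).le) hi
  have hsum : α (p + 1) - β (p + 1) ≤ (p + 1) * (α 1 * α (p + 1)) := by
    rw [hdiff]
    calc _ ≤ ∑ _j ∈ Finset.range (p + 1), α 1 * α (p + 1) :=
          Finset.sum_le_sum fun i hi => hcheb i (Finset.mem_range.1 hi)
      _ = _ := by simp
  have hα1 : (p + 1) * α 1 ≤ 1 / 2 := by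
    have h1 : h * α 1 ≤ x ⬝ᵥ x := by
      simp only [hα, pow_one]
      exact dotProduct_inv_mulVec_le hN hh hNh x
    have h2 : h * (2 * (p + 1) * α 1) ≤ h * 1 := by
      have := mul_le_mul_of_nonneg_left h1 (by positivity : (0 : ℝ) ≤ 2 * (p + 1))
      linarith
    linarith [le_of_mul_le_mul_left h2 hh]
  have hhalf : α (p + 1) / 2 ≤ β (p + 1) := by
    have := mul_le_mul_of_nonneg_right hα1 (hα0 (p + 1))
    linarith
  have hklein := klein_trace_inv_pow hN hN' p
  have htr : trace (N'⁻¹ ^ p) - trace (N'⁻¹ ^ (p + 1) * N) = β (p + 1) := by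
    have h1 : N'⁻¹ ^ p = N'⁻¹ ^ (p + 1) * N' := by
      rw [pow_succ, Matrix.mul_assoc, nonsing_inv_mul _ (isUnit_det_of_posDef hN'), Matrix.mul_one]
    rw [h1, ← trace_sub, ← Matrix.mul_sub, show N' - N = vecMulVec x x by rw [hN'def]; abel,
      mul_vecMulVec, trace_vecMulVec, dotProduct_comm]
  rw [htr] at hklein
  have := mul_le_mul_of_nonneg_left hhalf (Nat.cast_nonneg (α := ℝ) p)
  change _ ≤ _ - p / 2 * α (p + 1)
  linarith

lemma measurable_trace_inv_pow {Ω : Type*} [MeasurableSpace Ω] {A : Ω → Matrix d d ℝ}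
    (hA : ∀ i j, Measurable fun ω => A ω i j) (p : ℕ) :
    Measurable fun ω => trace ((A ω)⁻¹ ^ p) := by
  have h1 : ∀ B : Matrix d d ℝ, trace (B⁻¹ ^ p) = (B.det)⁻¹ ^ p * trace (B.adjugate ^ p) :=
    fun B => by rw [inv_def, smul_pow, trace_smul, Ring.inverse_eq_inv', smul_eq_mul]
  have hA' : @Measurable Ω (d → d → ℝ) _ _ A :=
    measurable_pi_iff.2 fun i => measurable_pi_iff.2 fun j => hA i j
  have hdet : Continuous fun B : d → d → ℝ => (Matrix.of B).det :=
    Continuous.matrix_det continuous_id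
  have hadj : Continuous fun B : d → d → ℝ => trace ((Matrix.of B).adjugate ^ p) :=
    ((Continuous.matrix_adjugate continuous_id).pow p).matrix_trace
  simp_rw [h1]
  exact ((hdet.measurable.comp hA').inv.pow_const p).mul (hadj.measurable.comp hA')

end MatrixTrace

/-! ### Lower tail of an empirical second moment matrix -/

section CovarianceMatrix
open Matrix

variable {d : Type*} {Ω : Type*} [MeasurableSpace Ω]

/-- The second moment matrix `𝔼 c cᵀ` of a random vector `c`. -/
noncomputable def secondMoment (μ : Measure Ω) (c : Ω → d → ℝ) : Matrix d d ℝ :=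
  Matrix.of fun i j => ∫ ω, c ω i * c ω j ∂μ

lemma secondMoment_isHermitian (μ : Measure Ω) (c : Ω → d → ℝ) :
    (secondMoment μ c).IsHermitian := by
  ext i j
  simp [secondMoment, mul_comm]

lemma dotProduct_mulVec_self_eq [Fintype d] (G : Matrix d d ℝ) (x : d → ℝ) :
    x ⬝ᵥ (G *ᵥ x) = ∑ i, ∑ j, G i j * (x j * x i) := by
  simp only [dotProduct, mulVec, Finset.mul_sum]
  exact Finset.sum_congr rfl fun i _ => Finset.sum_congr rfl fun j _ => by ring

lemma sq_dotProduct_le [Fintype d] (v w : d → ℝ) : (v ⬝ᵥ w) ^ 2 ≤ (v ⬝ᵥ v) * (w ⬝ᵥ w) := by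
  simp only [dotProduct, ← sq]
  exact Finset.sum_mul_sq_le_sq_mul_sq _ _ _

variable [Fintype d] {μ : Measure Ω} [IsProbabilityMeasure μ] {c : Ω → d → ℝ} {b : ℝ}

lemma integrable_coord_mul (hc : ∀ i, Measurable fun ω => c ω i)
    (hcb : ∀ᵐ ω ∂μ, c ω ⬝ᵥ c ω ≤ b) (i j : d) : Integrable (fun ω => c ω i * c ω j) μ := by
  refine Integrable.of_bound (C := b) ((hc i).mul (hc j)).aestronglyMeasurable ?_
  filter_upwards [hcb] with ω hω
  have h : ∀ k, c ω k ^ 2 ≤ b := fun k => by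
    refine le_trans ?_ hω
    simp only [dotProduct, ← sq]
    exact Finset.single_le_sum (f := fun k => c ω k ^ 2) (fun _ _ => sq_nonneg _)
      (Finset.mem_univ k)
  rw [Real.norm_eq_abs, abs_le]
  constructor <;> nlinarith [h i, h j, sq_nonneg (c ω i + c ω j), sq_nonneg (c ω i - c ω j)]

lemma integrable_dotProduct_mulVec (hc : ∀ i, Measurable fun ω => c ω i)
    (hcb : ∀ᵐ ω ∂μ, c ω ⬝ᵥ c ω ≤ b) (G : Matrix d d ℝ) :
    Integrable (fun ω => c ω ⬝ᵥ (G *ᵥ c ω)) μ := by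
  simp_rw [dotProduct_mulVec_self_eq]
  exact integrable_finsetSum _ fun i _ => integrable_finsetSum _ fun j _ =>
    (integrable_coord_mul hc hcb j i).const_mul _

lemma integral_dotProduct_mulVec (hc : ∀ i, Measurable fun ω => c ω i)
    (hcb : ∀ᵐ ω ∂μ, c ω ⬝ᵥ c ω ≤ b) (G : Matrix d d ℝ) :
    ∫ ω, c ω ⬝ᵥ (G *ᵥ c ω) ∂μ = trace (G * secondMoment μ c) := by
  simp_rw [dotProduct_mulVec_self_eq]
  have hI : ∀ i j, Integrable (fun ω => G i j * (c ω j * c ω i)) μ := fun i j =>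
    (integrable_coord_mul hc hcb j i).const_mul _
  have h1 := integral_finsetSum (μ := μ) Finset.univ
    (f := fun i ω => ∑ j, G i j * (c ω j * c ω i))
    fun i _ => integrable_finsetSum Finset.univ fun j _ => hI i j
  rw [h1]
  refine Finset.sum_congr rfl fun i _ => ?_
  have h2 := integral_finsetSum (μ := μ) Finset.univ
    (f := fun j ω => G i j * (c ω j * c ω i)) fun j _ => hI i j
  rw [h2, diag_apply, mul_apply]
  exact Finset.sum_congr rfl fun j _ => by rw [integral_const_mul]; rfl

lemma integral_dotProduct_self (hc : ∀ i, Measurable fun ω => c ω i)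
    (hcb : ∀ᵐ ω ∂μ, c ω ⬝ᵥ c ω ≤ b) :
    ∫ ω, c ω ⬝ᵥ c ω ∂μ = trace (secondMoment μ c) := by
  classical
  simpa using integral_dotProduct_mulVec hc hcb (1 : Matrix d d ℝ)

lemma integrable_dotProduct_self (hc : ∀ i, Measurable fun ω => c ω i)
    (hcb : ∀ᵐ ω ∂μ, c ω ⬝ᵥ c ω ≤ b) : Integrable (fun ω => c ω ⬝ᵥ c ω) μ := by
  classical
  simpa using integrable_dotProduct_mulVec hc hcb (1 : Matrix d d ℝ)

lemma trace_secondMoment_le (hc : ∀ i, Measurable fun ω => c ω i)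
    (hcb : ∀ᵐ ω ∂μ, c ω ⬝ᵥ c ω ≤ b) : trace (secondMoment μ c) ≤ b := by
  rw [← integral_dotProduct_self hc hcb]
  calc _ ≤ ∫ _ω, b ∂μ := integral_mono_ae (integrable_dotProduct_self hc hcb)
        (integrable_const _) hcb
    _ = b := by simp

lemma dotProduct_secondMoment (hc : ∀ i, Measurable fun ω => c ω i)
    (hcb : ∀ᵐ ω ∂μ, c ω ⬝ᵥ c ω ≤ b) (v : d → ℝ) :
    v ⬝ᵥ (secondMoment μ c *ᵥ v) = ∫ ω, (v ⬝ᵥ c ω) ^ 2 ∂μ := by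
  have h1 : ∀ ω, (v ⬝ᵥ c ω) ^ 2 = c ω ⬝ᵥ (vecMulVec v v *ᵥ c ω) := fun ω => by
    rw [vecMulVec_mulVec, sq, dotProduct_comm (c ω)]
    simp
  simp_rw [h1]
  rw [integral_dotProduct_mulVec hc hcb, vecMulVec_mul, trace_vecMulVec, dotProduct_mulVec,
    dotProduct_comm]

lemma secondMoment_posSemidef (hc : ∀ i, Measurable fun ω => c ω i)
    (hcb : ∀ᵐ ω ∂μ, c ω ⬝ᵥ c ω ≤ b) : (secondMoment μ c).PosSemidef := by
  refine .of_dotProduct_mulVec_nonneg (secondMoment_isHermitian μ c) fun v => ?_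
  rw [star_trivial, dotProduct_secondMoment hc hcb]
  exact integral_nonneg fun ω => sq_nonneg _

lemma dotProduct_secondMoment_le (hc : ∀ i, Measurable fun ω => c ω i)
    (hcb : ∀ᵐ ω ∂μ, c ω ⬝ᵥ c ω ≤ b) (v : d → ℝ) :
    v ⬝ᵥ (secondMoment μ c *ᵥ v) ≤ b * (v ⬝ᵥ v) := by
  rw [dotProduct_secondMoment hc hcb]
  have hv : 0 ≤ v ⬝ᵥ v := by simpa using dotProduct_star_self_nonneg v
  calc _ ≤ ∫ _ω, b * (v ⬝ᵥ v) ∂μ := by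
        refine integral_mono_of_nonneg (ae_of_all _ fun ω => sq_nonneg _) (integrable_const _) ?_
        filter_upwards [hcb] with ω hω
        refine (sq_dotProduct_le _ _).trans ?_
        rw [mul_comm]
        gcongr
    _ = _ := by simp

variable [DecidableEq d]

lemma trace_inv_pow_nonneg {N : Matrix d d ℝ} (hN : N.PosDef) (p : ℕ) :
    0 ≤ trace (N⁻¹ ^ p) := (hN.posSemidef.inv.pow p).trace_nonneg

lemma measurable_trace_inv_pow_add (hc : ∀ i, Measurable fun ω => c ω i) (N : Matrix d d ℝ)
    (p : ℕ) : Measurable fun ω => trace ((N + vecMulVec (c ω) (c ω))⁻¹ ^ p) :=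
  measurable_trace_inv_pow (fun i j => measurable_const.add ((hc i).mul (hc j))) p

lemma integrable_trace_inv_pow_add (hc : ∀ i, Measurable fun ω => c ω i)
    (hcb : ∀ᵐ ω ∂μ, c ω ⬝ᵥ c ω ≤ b) {N : Matrix d d ℝ} (hN : N.PosDef) {h : ℝ} (hh : 0 < h)
    (hNh : ∀ v, h * (v ⬝ᵥ v) ≤ v ⬝ᵥ (N *ᵥ v)) (p : ℕ) (hp : 2 * (p + 1) * b ≤ h) :
    Integrable (fun ω => trace ((N + vecMulVec (c ω) (c ω))⁻¹ ^ p)) μ := by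
  refine Integrable.of_bound (C := trace (N⁻¹ ^ p))
    (measurable_trace_inv_pow_add hc N p).aestronglyMeasurable ?_
  filter_upwards [hcb] with ω hω
  rw [Real.norm_of_nonneg (trace_inv_pow_nonneg (posDef_add_vecMulVec hN _) p)]
  refine (trace_inv_pow_add_vecMulVec_le hN hh hNh (c ω) p (le_trans (by gcongr) hp)).trans ?_
  have h1 : 0 ≤ c ω ⬝ᵥ (N⁻¹ ^ (p + 1) *ᵥ c ω) := by
    simpa using (hN.posSemidef.inv.pow (p + 1)).dotProduct_mulVec_nonneg (c ω)
  have : 0 ≤ p / 2 * (c ω ⬝ᵥ (N⁻¹ ^ (p + 1) *ᵥ c ω)) := by positivity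
  linarith

/-- Averaged over `c`, the barrier `tr N⁻ᵖ` after the random rank-one update `N + c cᵀ` is at most
its value after the deterministic update by half of the mean `𝔼 c cᵀ`. -/
lemma integral_trace_inv_pow_add_le (hc : ∀ i, Measurable fun ω => c ω i)
    (hcb : ∀ᵐ ω ∂μ, c ω ⬝ᵥ c ω ≤ b) {N : Matrix d d ℝ} (hN : N.PosDef) {h : ℝ} (hh : 0 < h)
    (hNh : ∀ v, h * (v ⬝ᵥ v) ≤ v ⬝ᵥ (N *ᵥ v)) (p : ℕ) (hp : 2 * (p + 1) * b ≤ h) :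
    ∫ ω, trace ((N + vecMulVec (c ω) (c ω))⁻¹ ^ p) ∂μ ≤
      trace ((N + (1 / 2 : ℝ) • secondMoment μ c)⁻¹ ^ p) := by
  set T := secondMoment μ c with hT
  have hI := integrable_dotProduct_mulVec hc hcb (N⁻¹ ^ (p + 1))
  have h1 : ∫ ω, trace ((N + vecMulVec (c ω) (c ω))⁻¹ ^ p) ∂μ ≤
      trace (N⁻¹ ^ p) - p / 2 * trace (N⁻¹ ^ (p + 1) * T) := by
    rw [hT, ← integral_dotProduct_mulVec hc hcb]
    calc _ ≤ ∫ ω, (trace (N⁻¹ ^ p) - p / 2 * (c ω ⬝ᵥ (N⁻¹ ^ (p + 1) *ᵥ c ω))) ∂μ := by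
          refine integral_mono_ae (integrable_trace_inv_pow_add hc hcb hN hh hNh p hp)
            ((integrable_const _).sub (hI.const_mul _)) ?_
          filter_upwards [hcb] with ω hω
          exact trace_inv_pow_add_vecMulVec_le hN hh hNh (c ω) p (le_trans (by gcongr) hp)
      _ = _ := by
          rw [integral_sub (integrable_const _) (hI.const_mul _), integral_const_mul]
          simp
  have hNT : (N + (1 / 2 : ℝ) • T).PosDef :=
    hN.add_posSemidef ((secondMoment_posSemidef hc hcb).smul (by norm_num))
  have h2 := klein_trace_inv_pow hNT hN p
  rw [Matrix.mul_add, trace_add, Matrix.mul_smul, trace_smul, smul_eq_mul, pow_succ,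
    Matrix.mul_assoc (N⁻¹ ^ p) N⁻¹ N, nonsing_inv_mul _ (isUnit_det_of_posDef hN),
    Matrix.mul_one, ← pow_succ] at h2
  linarith

/-- The barrier `tr M⁻ᵖ` minus its first-order expansion at `u I`. -/
noncomputable def barrier (u : ℝ) (p : ℕ) (M : Matrix d d ℝ) : ℝ :=
  trace (M⁻¹ ^ p) - Fintype.card d * u⁻¹ ^ p -
    p * (Fintype.card d * u⁻¹ ^ p - u⁻¹ ^ (p + 1) * trace M)

lemma barrier_eq_sum {M : Matrix d d ℝ} (hM : M.PosDef) (u : ℝ) (p : ℕ) :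
    ∃ (U : Matrix d d ℝ) (a : d → ℝ), Uᵀ * U = 1 ∧ U * Uᵀ = 1 ∧ (∀ i, 0 < a i) ∧
      M = U * diagonal a * Uᵀ ∧ barrier u p M =
        ∑ i, ((a i)⁻¹ ^ p - u⁻¹ ^ p - p * (u⁻¹ ^ p - u⁻¹ ^ (p + 1) * a i)) := by
  obtain ⟨U, a, hU1, hU2, ha, hMe, hMp⟩ := hM.exists_diagonalization
  refine ⟨U, a, hU2, hU1, ha, hMe, ?_⟩
  rw [barrier, hMp, trace_conj_diagonal hU2, show trace M = ∑ i, a i by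
    conv_lhs => rw [hMe]
    exact trace_conj_diagonal hU2 a]
  simp only [Finset.sum_sub_distrib, ← Finset.mul_sum, Finset.sum_const, Finset.card_univ,
    nsmul_eq_mul]

lemma barrier_nonneg {M : Matrix d d ℝ} (hM : M.PosDef) {u : ℝ} (hu : 0 < u) (p : ℕ) :
    0 ≤ barrier u p M := by
  obtain ⟨U, a, -, -, ha, -, h⟩ := barrier_eq_sum hM u p
  rw [h]
  exact Finset.sum_nonneg fun i _ => by linarith [inv_pow_tangent_le (ha i) hu p]

/-- With `a = u exp (-w)` the left-hand side is at least `u⁻ᵖ (exp (p w) - 1 - p w)`, and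
`w ≥ ε`. -/
lemma exp_le_scalar_barrier {a u ε : ℝ} (ha : 0 < a) (hu : 0 < u) (hε : 0 ≤ ε)
    (h : a ≤ u * (1 - ε)) (p : ℕ) :
    u⁻¹ ^ p * (Real.exp (p * ε) - 1 - p * ε) ≤
      a⁻¹ ^ p - u⁻¹ ^ p - p * (u⁻¹ ^ p - u⁻¹ ^ (p + 1) * a) := by
  obtain ⟨w, rfl⟩ : ∃ w, a = u * Real.exp (-w) :=
    ⟨-Real.log (a / u), by rw [neg_neg, Real.exp_log (div_pos ha hu)]; field_simp⟩
  have hw : ε ≤ w := by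
    have h1 : Real.exp (-w) ≤ 1 - ε := le_of_mul_le_mul_left h hu
    have h2 : 1 - ε ≤ Real.exp (-ε) := Real.one_sub_le_exp_neg ε
    have := Real.exp_le_exp.1 (h1.trans h2)
    linarith
  have h1 : (u * Real.exp (-w))⁻¹ ^ p = u⁻¹ ^ p * Real.exp (p * w) := by
    rw [mul_inv, mul_pow, ← Real.exp_neg, neg_neg, ← Real.exp_nat_mul]
  have h2 : u⁻¹ ^ (p + 1) * (u * Real.exp (-w)) = u⁻¹ ^ p * Real.exp (-w) := by
    rw [pow_succ]; field_simp
  have h3 : 1 - w ≤ Real.exp (-w) := Real.one_sub_le_exp_neg w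
  have hp : (0 : ℝ) ≤ p := Nat.cast_nonneg p
  have h4 : Real.exp (p * ε) + p * (w - ε) ≤ Real.exp (p * w) := by
    have e1 : Real.exp (p * w) = Real.exp (p * ε) * Real.exp (p * (w - ε)) := by
      rw [← Real.exp_add]; ring_nf
    have e2 : p * (w - ε) + 1 ≤ Real.exp (p * (w - ε)) := Real.add_one_le_exp _
    have e3 : 1 ≤ Real.exp (p * ε) := Real.one_le_exp (by positivity)
    have e4 : 0 ≤ p * (w - ε) := mul_nonneg hp (by linarith)
    rw [e1]
    nlinarith
  rw [h1, h2]
  have h5 : Real.exp (p * ε) - 1 - p * ε ≤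
      Real.exp (p * w) - 1 - p * (1 - Real.exp (-w)) := by
    have := mul_le_mul_of_nonneg_left h3 hp
    linarith
  have h6 := mul_le_mul_of_nonneg_left h5 (by positivity : 0 ≤ u⁻¹ ^ p)
  linarith

lemma exp_le_barrier {M : Matrix d d ℝ} (hM : M.PosDef) {u ε : ℝ} (hu : 0 < u) (hε : 0 ≤ ε)
    (p : ℕ) {v : d → ℝ} (hv : v ⬝ᵥ (M *ᵥ v) < u * (1 - ε) * (v ⬝ᵥ v)) :
    u⁻¹ ^ p * (Real.exp (p * ε) - 1 - p * ε) ≤ barrier u p M := by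
  obtain ⟨U, a, hU2, hU1, ha, hMe, h⟩ := barrier_eq_sum hM u p
  have hex : ∃ i, a i ≤ u * (1 - ε) := by
    by_contra! hcon
    have h1 : v ⬝ᵥ v = ∑ i, (Uᵀ *ᵥ v) i ^ 2 := by
      have := dotProduct_conj_diagonal_mulVec U (fun _ => 1) v
      simpa [hU1] using this
    rw [hMe, dotProduct_conj_diagonal_mulVec, h1, Finset.mul_sum] at hv
    refine absurd hv (not_lt.2 (Finset.sum_le_sum fun i _ => ?_))
    rw [mul_comm]
    exact mul_le_mul_of_nonneg_left (hcon i).le (sq_nonneg _)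
  obtain ⟨i, hi⟩ := hex
  rw [h]
  refine (exp_le_scalar_barrier (ha i) hu hε hi p).trans ?_
  exact Finset.single_le_sum
    (f := fun i => (a i)⁻¹ ^ p - u⁻¹ ^ p - p * (u⁻¹ ^ p - u⁻¹ ^ (p + 1) * a i))
    (fun j _ => by linarith [inv_pow_tangent_le (ha j) hu p]) (Finset.mem_univ i)

/-- Lower tail of an empirical second moment matrix, relative to half of the true one. The number
`d` of coordinates does not enter the bound. -/
lemma measure_secondMoment_lower_tail (hc : ∀ i, Measurable fun ω => c ω i) (hb : 0 < b)
    (hcb : ∀ᵐ ω ∂μ, c ω ⬝ᵥ c ω ≤ b) {n p : ℕ} (hnp : 4 * (p + 1) ≤ n) {ε : ℝ} (hε : 0 ≤ ε) :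
    (Measure.pi fun _ : Fin n => μ)
        {z | ∃ v : d → ℝ, n * b * ε * (v ⬝ᵥ v) <
          n / 2 * (v ⬝ᵥ (secondMoment μ c *ᵥ v)) - ∑ i, (v ⬝ᵥ c (z i)) ^ 2} *
      ENNReal.ofReal (Real.exp (p * ε) - 1 - p * ε) ≤ ENNReal.ofReal (p / 2) := by
  set T := secondMoment μ c with hT
  have hn : (0 : ℝ) < n := by exact_mod_cast (by omega : 0 < n)
  have hnp' : (4 * (p + 1) : ℝ) ≤ n := by exact_mod_cast hnp
  set u : ℝ := n * b with hu
  have hu0 : 0 < u := by positivity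
  have hT0 : 0 ≤ trace T := (secondMoment_posSemidef hc hcb).trace_nonneg
  set g : ℝ := p * u⁻¹ ^ (p + 1) * (trace T / 2) with hg
  have hg0 : 0 ≤ g := by positivity
  let N : ℕ → Matrix d d ℝ → Matrix d d ℝ := fun k S => u • (1 : Matrix d d ℝ) - (k / 2 : ℝ) • T + S
  -- The barrier stays on the safe side of its pole whatever the sample is.
  have hNlow : ∀ (k : ℕ) (S : Matrix d d ℝ), k ≤ n → S.PosSemidef → ∀ v,
      u / 2 * (v ⬝ᵥ v) ≤ v ⬝ᵥ (N k S *ᵥ v) := fun k S hk hS v => by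
    have h1 := dotProduct_secondMoment_le hc hcb v
    have h2 : 0 ≤ v ⬝ᵥ (S *ᵥ v) := by simpa using hS.dotProduct_mulVec_nonneg v
    have hv : 0 ≤ v ⬝ᵥ v := by simpa using dotProduct_star_self_nonneg v
    have hk' : (k : ℝ) ≤ n := by exact_mod_cast hk
    simp only [N, add_mulVec, sub_mulVec, smul_mulVec, one_mulVec, dotProduct_add, dotProduct_sub,
      dotProduct_smul, smul_eq_mul]
    have h3 : (k / 2 : ℝ) * (v ⬝ᵥ (T *ᵥ v)) ≤ n / 2 * (b * (v ⬝ᵥ v)) :=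
      mul_le_mul (by linarith) h1
        (by simpa using (secondMoment_posSemidef hc hcb).dotProduct_mulVec_nonneg v)
        (by positivity)
    rw [hu]
    linarith
  have hNpos : ∀ (k : ℕ) (S : Matrix d d ℝ), k ≤ n → S.PosSemidef → (N k S).PosDef :=
    fun k S hk hS => by
      refine .of_dotProduct_mulVec_pos ?_ fun v hv => ?_
      · refine IsHermitian.add (IsHermitian.sub ?_ ?_) hS.1
        · simp [IsHermitian]
        · have := secondMoment_isHermitian μ c
          rw [IsHermitian, conjTranspose_smul, this.eq, star_trivial]
      · have h1 : 0 < v ⬝ᵥ v := by simpa using dotProduct_star_self_pos_iff.2 hv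
        rw [star_trivial]
        exact (by positivity : 0 < u / 2 * (v ⬝ᵥ v)).trans_le (hNlow k S hk hS v)
  have hX : ∀ ω, (vecMulVec (c ω) (c ω)).PosSemidef := fun ω => by
    simpa using posSemidef_vecMulVec_self_star (c ω)
  have hXsum : ∀ z : Fin n → Ω, (0 + ∑ i, vecMulVec (c (z i)) (c (z i))).PosSemidef := fun z => by
    rw [zero_add]; exact posSemidef_sum _ fun i _ => hX _
  have hmeas : ∀ (m k : ℕ) (S : Matrix d d ℝ), Measurable fun z : Fin m → Ω =>
      barrier u p (N k (S + ∑ i, vecMulVec (c (z i)) (c (z i)))) := fun m k S => by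
    have hent : ∀ i j, Measurable fun z : Fin m → Ω =>
        (N k (S + ∑ i, vecMulVec (c (z i)) (c (z i)))) i j := fun i j => by
      simp only [N, Matrix.add_apply, Matrix.sum_apply, vecMulVec_apply]
      exact measurable_const.add (measurable_const.add (Finset.measurable_sum _ fun l _ =>
        ((hc i).comp (measurable_pi_apply l)).mul ((hc j).comp (measurable_pi_apply l))))
    have htr : Measurable fun z : Fin m → Ω =>
        trace (N k (S + ∑ i, vecMulVec (c (z i)) (c (z i)))) := by
      simp only [trace, diag_apply]
      exact Finset.measurable_sum _ fun i _ => hent i i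
    exact ((measurable_trace_inv_pow hent p).sub_const _).sub
      ((measurable_const.sub (htr.const_mul _)).const_mul _)
  have key := lintegral_sum_le μ (fun ω => vecMulVec (c ω) (c ω)) {S | S.PosSemidef}
    (fun S hS ω => PosSemidef.add hS (hX ω))
    (fun k S => ENNReal.ofReal (barrier u p (N k S) + (n - k) * g))
    (fun m k S => ENNReal.measurable_ofReal.comp ((hmeas m k S).add_const _)) n 0
    (fun k _ hk S hS => by
      rw [zero_add] at hk
      have hkn : ((k + 1 : ℕ) : ℝ) ≤ n := by exact_mod_cast hk
      have hadd : ∀ ω, N (k + 1) (S + vecMulVec (c ω) (c ω)) =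
          N (k + 1) S + vecMulVec (c ω) (c ω) := fun ω => by simp only [N, add_assoc]
      have hNk : N (k + 1) S + (1 / 2 : ℝ) • T = N k S := by
        simp only [N]
        have : ((k + 1 : ℕ) / 2 : ℝ) • T = (k / 2 : ℝ) • T + (1 / 2 : ℝ) • T := by
          rw [← add_smul]; push_cast; ring_nf
        rw [this]
        abel
      have hposk := hNpos (k + 1) S hk hS
      have hp2 : 2 * (p + 1) * b ≤ u / 2 := by rw [hu]; nlinarith
      have hI1 := integrable_trace_inv_pow_add hc hcb hposk (by positivity)
        (hNlow (k + 1) S hk hS) p hp2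
      have hI2 := integrable_dotProduct_self hc hcb
      have hle := integral_trace_inv_pow_add_le hc hcb hposk (by positivity)
        (hNlow (k + 1) S hk hS) p hp2
      rw [← hT, hNk] at hle
      have hform : ∀ ω, barrier u p (N (k + 1) (S + vecMulVec (c ω) (c ω))) +
          (n - (k + 1 : ℕ)) * g = trace ((N (k + 1) S + vecMulVec (c ω) (c ω))⁻¹ ^ p) +
            (p * u⁻¹ ^ (p + 1) * (c ω ⬝ᵥ c ω) + (p * u⁻¹ ^ (p + 1) * trace (N (k + 1) S) -
              (1 + p) * (Fintype.card d * u⁻¹ ^ p) + (n - (k + 1 : ℕ)) * g)) := fun ω => by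
        rw [hadd, barrier, trace_add, trace_vecMulVec]
        ring
      have hI3 := hI2.const_mul (p * u⁻¹ ^ (p + 1))
      rw [← ofReal_integral_eq_lintegral_ofReal]
      · apply ENNReal.ofReal_le_ofReal
        simp_rw [hform]
        have hI4 : ∀ C : ℝ, Integrable (fun ω => p * u⁻¹ ^ (p + 1) * (c ω ⬝ᵥ c ω) + C) μ :=
          fun C => hI3.add (integrable_const C)
        rw [integral_add hI1 (hI4 _), integral_add hI3 (integrable_const _),
          integral_const_mul, integral_dotProduct_self hc hcb, ← hT]
        simp only [integral_const, probReal_univ, one_smul]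
        have htr : trace (N k S) = trace (N (k + 1) S) + trace T / 2 := by
          rw [← hNk, trace_add, trace_smul, smul_eq_mul]; ring
        rw [barrier, htr]
        push_cast
        rw [hg]
        linarith
      · simp_rw [hform]
        exact hI1.add (hI3.add (integrable_const _))
      · refine ae_of_all _ fun ω => add_nonneg (barrier_nonneg ?_ hu0 p)
          (mul_nonneg (by linarith) hg0)
        exact hNpos (k + 1) _ hk (PosSemidef.add hS (hX ω)))
    0 PosSemidef.zero
  have hinit : barrier u p (N 0 0) = 0 := by
    have h1 : N 0 0 = u • (1 : Matrix d d ℝ) := by simp [N]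
    have h2 : (u • (1 : Matrix d d ℝ))⁻¹ = u⁻¹ • 1 := by
      apply inv_eq_right_inv
      rw [smul_mul_smul_comm, mul_inv_cancel₀ hu0.ne']
      simp
    rw [barrier, h1, h2, smul_pow, one_pow, trace_smul, trace_smul, trace_one, smul_eq_mul,
      smul_eq_mul, pow_succ]
    field_simp
    ring
  have hng : n * g ≤ p / 2 * u⁻¹ ^ p := by
    have h1 := trace_secondMoment_le hc hcb
    rw [← hT] at h1
    calc n * g = p / 2 * (u⁻¹ ^ (p + 1) * (n * trace T)) := by rw [hg]; ring
      _ ≤ p / 2 * (u⁻¹ ^ (p + 1) * u) := by rw [hu]; gcongr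
      _ = _ := by rw [pow_succ]; field_simp
  simp only [zero_add, hinit, sub_self, zero_mul, add_zero, Nat.cast_zero, sub_zero] at key
  have hup : 0 < u⁻¹ ^ p := by positivity
  have hsub : {z : Fin n → Ω | ∃ v : d → ℝ, n * b * ε * (v ⬝ᵥ v) <
        n / 2 * (v ⬝ᵥ (T *ᵥ v)) - ∑ i, (v ⬝ᵥ c (z i)) ^ 2} ⊆
      {z | ENNReal.ofReal (u⁻¹ ^ p * (Real.exp (p * ε) - 1 - p * ε)) ≤
        ENNReal.ofReal (barrier u p (N n (∑ i, vecMulVec (c (z i)) (c (z i)))))} := by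
    rintro z ⟨v, hv⟩
    apply ENNReal.ofReal_le_ofReal
    have hz := hXsum z
    rw [zero_add] at hz
    refine exp_le_barrier (hNpos n _ le_rfl hz) hu0 hε p (v := v) ?_
    have h1 : v ⬝ᵥ ((∑ i, vecMulVec (c (z i)) (c (z i))) *ᵥ v) = ∑ i, (v ⬝ᵥ c (z i)) ^ 2 := by
      rw [sum_mulVec, dotProduct_sum]
      refine Finset.sum_congr rfl fun i _ => ?_
      rw [vecMulVec_mulVec, dotProduct_comm (c (z i)) v]
      simp [sq]
    simp only [N, add_mulVec, sub_mulVec, smul_mulVec, one_mulVec, dotProduct_add, dotProduct_sub,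
      dotProduct_smul, smul_eq_mul, h1]
    linarith
  have hmarkov := mul_meas_ge_le_lintegral
    (μ := Measure.pi fun _ : Fin n => μ)
    (ENNReal.measurable_ofReal.comp (by simpa using hmeas n n 0))
    (ENNReal.ofReal (u⁻¹ ^ p * (Real.exp (p * ε) - 1 - p * ε)))
  have hfin : ENNReal.ofReal (u⁻¹ ^ p) *
      ((Measure.pi fun _ : Fin n => μ)
        {z | ∃ v : d → ℝ, n * b * ε * (v ⬝ᵥ v) <
          n / 2 * (v ⬝ᵥ (T *ᵥ v)) - ∑ i, (v ⬝ᵥ c (z i)) ^ 2} *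
        ENNReal.ofReal (Real.exp (p * ε) - 1 - p * ε)) ≤
      ENNReal.ofReal (u⁻¹ ^ p) * ENNReal.ofReal (p / 2) := by
    rw [← ENNReal.ofReal_mul hup.le]
    calc _ = ENNReal.ofReal (u⁻¹ ^ p * (Real.exp (p * ε) - 1 - p * ε)) *
          (Measure.pi fun _ : Fin n => μ) _ := by rw [ENNReal.ofReal_mul hup.le]; ring
      _ ≤ _ := mul_le_mul_right (measure_mono hsub) _
      _ ≤ _ := hmarkov
      _ ≤ _ := key
      _ ≤ _ := ENNReal.ofReal_le_ofReal (by linarith)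
  exact (ENNReal.mul_le_mul_iff_right (by simpa using hup) ENNReal.ofReal_ne_top).1 hfin

end CovarianceMatrix

/-! ### Empirical covariance and risk in the Hilbert space -/

section HilbertCovariance

variable [MeasurableSpace H] [BorelSpace H] [SecondCountableTopology H]
  {Ω : Type*} [MeasurableSpace Ω] {μ : Measure Ω} [IsProbabilityMeasure μ] {ξ : Ω → H} {κ : ℝ}

lemma continuous_integral_inner_sq (hξ : Measurable ξ) (hξκ : ∀ᵐ ω ∂μ, ‖ξ ω‖ ≤ κ) :
    Continuous fun v => ∫ ω, inner ℝ v (ξ ω) ^ 2 ∂μ := by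
  refine continuous_iff_continuousAt.2 fun v₀ => ?_
  refine continuousAt_of_dominated (bound := fun _ => ((‖v₀‖ + 1) * κ) ^ 2) ?_ ?_
    (integrable_const _) ?_
  · exact Eventually.of_forall fun v => ((measurable_const.inner hξ).pow_const 2).aestronglyMeasurable
  · have h1 : ∀ᶠ v in nhds v₀, ‖v‖ < ‖v₀‖ + 1 :=
      continuous_norm.continuousAt.eventually_lt continuousAt_const (by linarith)
    filter_upwards [h1] with v hv
    filter_upwards [hξκ] with ω hω
    rw [norm_pow]
    exact pow_le_pow_left₀ (norm_nonneg _) ((norm_inner_le_norm _ _).trans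
      (mul_le_mul hv.le hω (norm_nonneg _) (by positivity))) 2
  · exact ae_of_all _ fun ω => by fun_prop

lemma measure_lower_tail_of_finiteDimensional (hξ : Measurable ξ) (hκ : 0 < κ)
    (hξκ : ∀ᵐ ω ∂μ, ‖ξ ω‖ ≤ κ) (V : Submodule ℝ H) [FiniteDimensional ℝ V] {n p : ℕ}
    (hnp : 4 * (p + 1) ≤ n) {ε : ℝ} (hε : 0 ≤ ε) :
    (Measure.pi fun _ : Fin n => μ)
        {z | ∃ v ∈ V, n * κ ^ 2 * ε * ‖v‖ ^ 2 <
          n / 2 * ∫ ω, inner ℝ v (ξ ω) ^ 2 ∂μ - ∑ i, inner ℝ v (ξ (z i)) ^ 2} *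
      ENNReal.ofReal (Real.exp (p * ε) - 1 - p * ε) ≤ ENNReal.ofReal (p / 2) := by
  let b := stdOrthonormalBasis ℝ V
  have hbo : Orthonormal ℝ fun i => (b i : H) := b.orthonormal.comp_linearIsometry V.subtypeₗᵢ
  let c : Ω → Fin (Module.finrank ℝ V) → ℝ := fun ω i => inner ℝ (b i : H) (ξ ω)
  have hc : ∀ i, Measurable fun ω => c ω i := fun i => measurable_const.inner hξ
  have hcb : ∀ᵐ ω ∂μ, dotProduct (c ω) (c ω) ≤ κ ^ 2 := by
    filter_upwards [hξκ] with ω hω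
    have h1 := hbo.sum_inner_products_le (ξ ω) (s := Finset.univ)
    simp only [dotProduct, ← sq, c]
    simp only [Real.norm_eq_abs, sq_abs] at h1
    exact h1.trans (pow_le_pow_left₀ (norm_nonneg _) hω 2)
  refine le_trans ?_ (measure_secondMoment_lower_tail hc (by positivity : 0 < κ ^ 2) hcb hnp hε)
  refine mul_le_mul_left (measure_mono ?_) _
  rintro z ⟨v, hv, hlt⟩
  have hexp : ∀ x : H, inner ℝ v x =
      dotProduct (fun i => inner ℝ (b i : H) v) (fun i => inner ℝ (b i : H) x) := fun x => by
    have h1 : v = ∑ i, (inner ℝ (b i : H) v : ℝ) • (b i : H) := by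
      have := congrArg (Subtype.val) (b.sum_repr' ⟨v, hv⟩)
      simpa using this.symm
    conv_lhs => rw [h1]
    simp [sum_inner, inner_smul_left, dotProduct]
  refine ⟨fun i => inner ℝ (b i : H) v, ?_⟩
  rw [dotProduct_secondMoment hc hcb, ← hexp v, real_inner_self_eq_norm_sq]
  simp only [c, ← hexp]
  exact hlt

/-- Relative lower tail of the empirical covariance in a separable Hilbert space. The event is a
countable increasing union of events for finite-dimensional subspaces, with bounds that do not
depend on the dimension. -/
lemma measure_lower_tail (hξ : Measurable ξ) (hκ : 0 < κ) (hξκ : ∀ᵐ ω ∂μ, ‖ξ ω‖ ≤ κ) {n p : ℕ}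
    (hnp : 4 * (p + 1) ≤ n) {ε : ℝ} (hε : 0 ≤ ε) :
    (Measure.pi fun _ : Fin n => μ)
        {z | ∃ v, n * κ ^ 2 * ε * ‖v‖ ^ 2 <
          n / 2 * ∫ ω, inner ℝ v (ξ ω) ^ 2 ∂μ - ∑ i, inner ℝ v (ξ (z i)) ^ 2} *
      ENNReal.ofReal (Real.exp (p * ε) - 1 - p * ε) ≤ ENNReal.ofReal (p / 2) := by
  let D := TopologicalSpace.denseSeq H
  let V : ℕ → Submodule ℝ H := fun N => Submodule.span ℝ (D '' Set.Iic N)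
  have hVfin : ∀ N, FiniteDimensional ℝ (V N) := fun N =>
    FiniteDimensional.span_of_finite ℝ ((Set.finite_Iic N).image D)
  have hVmono : Monotone V := fun N N' h =>
    Submodule.span_mono (Set.image_mono (Set.Iic_subset_Iic.2 h))
  let bad : ℕ → Set (Fin n → Ω) := fun N => {z | ∃ v ∈ V N, n * κ ^ 2 * ε * ‖v‖ ^ 2 <
    n / 2 * ∫ ω, inner ℝ v (ξ ω) ^ 2 ∂μ - ∑ i, inner ℝ v (ξ (z i)) ^ 2}
  have hbad : Monotone bad := fun N N' h z ⟨v, hv, hlt⟩ => ⟨v, hVmono h hv, hlt⟩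
  have hsub : {z : Fin n → Ω | ∃ v, n * κ ^ 2 * ε * ‖v‖ ^ 2 <
      n / 2 * ∫ ω, inner ℝ v (ξ ω) ^ 2 ∂μ - ∑ i, inner ℝ v (ξ (z i)) ^ 2} ⊆ ⋃ N, bad N := by
    rintro z ⟨v, hlt⟩
    have hopen : IsOpen {v : H | n * κ ^ 2 * ε * ‖v‖ ^ 2 <
        n / 2 * ∫ ω, inner ℝ v (ξ ω) ^ 2 ∂μ - ∑ i, inner ℝ v (ξ (z i)) ^ 2} := by
      refine isOpen_lt (by fun_prop) (Continuous.sub ?_ (by fun_prop))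
      exact (continuous_integral_inner_sq hξ hξκ).const_mul _
    obtain ⟨N, hN⟩ := (TopologicalSpace.denseRange_denseSeq H).exists_mem_open hopen ⟨v, hlt⟩
    exact Set.mem_iUnion.2 ⟨N, D N, Submodule.subset_span ⟨N, le_refl N, rfl⟩, hN⟩
  refine (mul_le_mul_left (measure_mono hsub) _).trans ?_
  rw [hbad.measure_iUnion, ENNReal.iSup_mul]
  exact iSup_le fun N => measure_lower_tail_of_finiteDimensional hξ hκ hξκ (V N) hnp hε

end HilbertCovariance

section Risk

variable [MeasurableSpace H] {ρ : Measure (H × ℝ)} {κ M : ℝ}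

lemma risk_minimizer_le {wstar : H} (hmin : risk ρ wstar = ⨅ w : H, risk ρ w) (w : H) :
    risk ρ wstar ≤ risk ρ w := by
  rw [hmin]
  exact ciInf_le ⟨0, by rintro _ ⟨v, rfl⟩; exact integral_nonneg fun p => sq_nonneg _⟩ w

/-- A two-point bound on inner products bounds the norm: at a point `x` of the support, the open
set `{x' | κ² < ⟨x, x'⟩}` is null, hence does not contain `x` itself. -/
lemma ae_norm_le_of_ae_inner_le [SecondCountableTopology H] (ν : Measure H) (hκ : 0 < κ)
    (hX : ∀ᵐ x ∂ν, ∀ᵐ x' ∂ν, inner ℝ x x' ≤ κ ^ 2) : ∀ᵐ x ∂ν, ‖x‖ ≤ κ := by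
  filter_upwards [hX, ν.support_mem_ae] with x hx hsupp
  by_contra hlt
  have hopen : IsOpen {x' : H | κ ^ 2 < inner ℝ x x'} := isOpen_lt (by fun_prop) (by fun_prop)
  have hmem : {x' : H | κ ^ 2 < inner ℝ x x'} ∈ nhds x := by
    refine hopen.mem_nhds ?_
    rw [Set.mem_ofPred_eq, real_inner_self_eq_norm_sq]
    exact pow_lt_pow_left₀ (not_le.1 hlt) hκ.le two_ne_zero
  have hpos := (Measure.mem_support_iff_forall _).1 hsupp _ hmem
  refine hpos.ne' ?_
  rw [ae_iff] at hx
  simpa using hx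

variable [BorelSpace H] [SecondCountableTopology H] [IsProbabilityMeasure ρ]

lemma integrable_residual_mul_inner (hX : ∀ᵐ p ∂ρ, ‖p.1‖ ≤ κ) (hY : ∀ᵐ p ∂ρ, |p.2| < M) (w v : H) :
    Integrable (fun p => (inner ℝ w p.1 - p.2) * inner ℝ v p.1) ρ := by
  refine Integrable.of_bound (C := (‖w‖ * κ + M) * (‖v‖ * κ)) ?_ ?_
  · exact (((measurable_const.inner measurable_fst).sub measurable_snd).mul
      (measurable_const.inner measurable_fst)).aestronglyMeasurable
  · filter_upwards [hX, hY] with p hp hp'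
    rw [norm_mul]
    have h1 : ‖(inner ℝ w p.1 : ℝ)‖ ≤ ‖w‖ * κ := (norm_inner_le_norm _ _).trans (by gcongr)
    have h2 : ‖(inner ℝ v p.1 : ℝ)‖ ≤ ‖v‖ * κ := (norm_inner_le_norm _ _).trans (by gcongr)
    have h3 : ‖inner ℝ w p.1 - p.2‖ ≤ ‖w‖ * κ + M :=
      (norm_sub_le _ _).trans (add_le_add h1 hp'.le)
    exact mul_le_mul h3 h2 (norm_nonneg _) ((norm_nonneg _).trans h3)

lemma integrable_residual_sq (hX : ∀ᵐ p ∂ρ, ‖p.1‖ ≤ κ) (hY : ∀ᵐ p ∂ρ, |p.2| < M) (w : H) :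
    Integrable (fun p => (inner ℝ w p.1 - p.2) ^ 2) ρ := by
  refine Integrable.of_bound (C := (‖w‖ * κ + M) ^ 2) ?_ ?_
  · exact (((measurable_const.inner measurable_fst).sub
      measurable_snd).pow_const 2).aestronglyMeasurable
  · filter_upwards [hX, hY] with p hp hp'
    rw [norm_pow]
    have h1 : ‖(inner ℝ w p.1 : ℝ)‖ ≤ ‖w‖ * κ := (norm_inner_le_norm _ _).trans (by gcongr)
    exact pow_le_pow_left₀ (norm_nonneg _) ((norm_sub_le _ _).trans (add_le_add h1 hp'.le)) 2

lemma integrable_inner_sq (hX : ∀ᵐ p ∂ρ, ‖p.1‖ ≤ κ) (v : H) :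
    Integrable (fun p : H × ℝ => inner ℝ v p.1 ^ 2) ρ := by
  refine Integrable.of_bound (C := (‖v‖ * κ) ^ 2) ?_ ?_
  · exact ((measurable_const.inner measurable_fst).pow_const 2).aestronglyMeasurable
  · filter_upwards [hX] with p hp
    rw [norm_pow]
    exact pow_le_pow_left₀ (norm_nonneg _) ((norm_inner_le_norm _ _).trans (by gcongr)) 2

lemma risk_add (hX : ∀ᵐ p ∂ρ, ‖p.1‖ ≤ κ) (hY : ∀ᵐ p ∂ρ, |p.2| < M) (w v : H) :
    risk ρ (w + v) = risk ρ w + 2 * ∫ p, (inner ℝ w p.1 - p.2) * inner ℝ v p.1 ∂ρ +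
      ∫ p, inner ℝ v p.1 ^ 2 ∂ρ := by
  have h1 := integrable_residual_sq hX hY w
  have h2 := (integrable_residual_mul_inner hX hY w v).const_mul 2
  have h3 := integrable_inner_sq hX v
  have h4 : Integrable (fun p : H × ℝ => (inner ℝ w p.1 - p.2) ^ 2 +
      2 * ((inner ℝ w p.1 - p.2) * inner ℝ v p.1)) ρ := h1.add h2
  rw [risk, risk, ← integral_const_mul, ← integral_add h1 h2, ← integral_add h4 h3]
  refine integral_congr_ae (ae_of_all _ fun p => ?_)
  simp only [inner_add_left]
  ring

/-- The normal equations at a minimizer of the risk. -/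
lemma integral_residual_mul_inner_eq_zero (hX : ∀ᵐ p ∂ρ, ‖p.1‖ ≤ κ) (hY : ∀ᵐ p ∂ρ, |p.2| < M)
    {wstar : H} (hmin : risk ρ wstar = ⨅ w : H, risk ρ w) (v : H) :
    ∫ p, (inner ℝ wstar p.1 - p.2) * inner ℝ v p.1 ∂ρ = 0 := by
  set b := ∫ p, (inner ℝ wstar p.1 - p.2) * inner ℝ v p.1 ∂ρ with hb
  set a := ∫ p, inner ℝ v p.1 ^ 2 ∂ρ with ha
  have ha0 : 0 ≤ a := integral_nonneg fun p => sq_nonneg _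
  have h1 : ∀ s : ℝ, 0 ≤ 2 * (s * b) + s ^ 2 * a := fun s => by
    have h2 := risk_minimizer_le hmin (wstar + s • v)
    rw [risk_add hX hY] at h2
    have h3 : ∫ p, (inner ℝ wstar p.1 - p.2) * inner ℝ (s • v) p.1 ∂ρ = s * b := by
      rw [hb, ← integral_const_mul]
      refine integral_congr_ae (ae_of_all _ fun p => ?_)
      simp only [inner_smul_left, conj_trivial]
      ring
    have h4 : ∫ p, inner ℝ (s • v) p.1 ^ 2 ∂ρ = s ^ 2 * a := by
      rw [ha, ← integral_const_mul]
      refine integral_congr_ae (ae_of_all _ fun p => ?_)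
      simp only [inner_smul_left, conj_trivial]
      ring
    rw [h3, h4] at h2
    linarith
  have h5 := h1 (-b / (a + 1))
  have h6 : 2 * (-b / (a + 1) * b) + (-b / (a + 1)) ^ 2 * a =
      -(b ^ 2 * (a + 2)) / (a + 1) ^ 2 := by
    field_simp
    ring
  rw [h6, le_div_iff₀ (by positivity)] at h5
  have h7 : b ^ 2 ≤ 0 := by nlinarith [sq_nonneg b]
  exact pow_eq_zero_iff two_ne_zero |>.1 (le_antisymm h7 (sq_nonneg b))

lemma excessRisk_eq (hX : ∀ᵐ p ∂ρ, ‖p.1‖ ≤ κ) (hY : ∀ᵐ p ∂ρ, |p.2| < M)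
    {wstar : H} (hmin : risk ρ wstar = ⨅ w : H, risk ρ w) (w : H) :
    excessRisk ρ w = ∫ p, inner ℝ (w - wstar) p.1 ^ 2 ∂ρ := by
  have h := risk_add hX hY wstar (w - wstar)
  rw [add_sub_cancel, integral_residual_mul_inner_eq_zero hX hY hmin] at h
  rw [excessRisk, ← hmin, h]
  ring

end Risk

/-! ### Bounds with high probability, and early stopping -/

/-- The sample size condition leaves room for an exponent `p` of order `n` at which the tail bound
`(p / 2) / (exp (p ε) - 1 - p ε)`, with `ε = 1 / φ`, is at most `δ / 2`. -/
lemma exists_tail_exponent {φ δ : ℝ} {n : ℕ} (hφ : 1 ≤ φ) (hδ : 0 < δ) (hδ' : δ < 1 / 2)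
    (hn : 16 * φ * Real.log (16 * φ / δ) ≤ n) :
    ∃ p : ℕ, 0 < p ∧ 4 * (p + 1) ≤ n ∧
      p / δ ≤ Real.exp (p * (1 / φ)) - 1 - p * (1 / φ) := by
  have hφ0 : 0 < φ := by linarith
  have h32 : 32 ≤ 16 * φ / δ := by
    rw [le_div_iff₀ hδ]; linarith
  have hlog : 1 ≤ Real.log (16 * φ / δ) := by
    rw [Real.le_log_iff_exp_le (by linarith)]
    linarith [Real.exp_one_lt_d9]
  have hn16 : (16 : ℝ) ≤ n := by nlinarith
  have hn16' : 16 ≤ n := by exact_mod_cast hn16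
  have hp8 : (n : ℝ) / 8 ≤ ((n / 4 - 1 : ℕ) : ℝ) := by
    have h1 : n ≤ 8 * (n / 4 - 1) := by omega
    have h2 : (n : ℝ) ≤ 8 * ((n / 4 - 1 : ℕ) : ℝ) := by exact_mod_cast h1
    linarith
  refine ⟨n / 4 - 1, by omega, by omega, ?_⟩
  set p : ℝ := ((n / 4 - 1 : ℕ) : ℝ)
  have hp0 : 0 ≤ p := by linarith
  set s := p * (1 / φ) with hs
  have hs0 : 0 ≤ s := by positivity
  have hps : p = s * φ := by rw [hs]; field_simp
  have hs1 : 2 * Real.log (16 * φ / δ) ≤ s := by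
    rw [hs, mul_one_div, le_div_iff₀ hφ0]
    linarith
  have h1 : 16 * φ / δ ≤ Real.exp (s / 2) := by
    rw [← Real.log_le_iff_le_exp (by positivity)]
    linarith
  -- `exp s - 1 = 2 exp (s / 2) sinh (s / 2) ≥ s exp (s / 2)`.
  have h2 : s * Real.exp (s / 2) ≤ Real.exp s - 1 := by
    have h3 : s / 2 ≤ Real.sinh (s / 2) := Real.self_le_sinh_iff.2 (by linarith)
    have h4 : Real.exp s - 1 = 2 * (Real.exp (s / 2) * Real.sinh (s / 2)) := by
      have e1 : Real.exp s = Real.exp (s / 2) * Real.exp (s / 2) := by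
        rw [← Real.exp_add]; ring_nf
      have e2 : Real.exp (s / 2) * Real.exp (-(s / 2)) = 1 := by
        rw [← Real.exp_add]; simp
      rw [Real.sinh_eq, e1]
      linear_combination e2
    rw [h4]
    nlinarith [Real.exp_pos (s / 2)]
  have h5 : φ / δ + 1 ≤ Real.exp (s / 2) := by
    have : 1 ≤ φ / δ := by rw [le_div_iff₀ hδ]; linarith
    have e : 16 * φ / δ = 16 * (φ / δ) := by ring
    linarith
  have h6 : s * (φ / δ + 1) ≤ s * Real.exp (s / 2) := mul_le_mul_of_nonneg_left h5 hs0
  have h7 : p / δ = s * (φ / δ) := by rw [hps]; ring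
  rw [h7]
  linarith

lemma ae_pi_forall {Ω : Type*} [MeasurableSpace Ω] {μ : Measure Ω} [IsProbabilityMeasure μ]
    {P : Ω → Prop} (hP : ∀ᵐ ω ∂μ, P ω) (n : ℕ) :
    ∀ᵐ z ∂(Measure.pi fun _ : Fin n => μ), ∀ i, P (z i) :=
  ae_all_iff.2 fun i =>
    (measurePreserving_eval (fun _ : Fin n => μ) i).quasiMeasurePreserving.ae hP

section Main

variable [MeasurableSpace H] [BorelSpace H] [SecondCountableTopology H]
  {ρ : Measure (H × ℝ)} [IsProbabilityMeasure ρ] {κ M : ℝ}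

/-- On the event where the empirical covariance is not too small and the empirical gradient at the
minimizer is not too large, the excess risk obeys the deterministic bound. -/
lemma excessRisk_le_of_good_sample {K : ℝ} {a b c φ : ℕ → ℝ}
    (hX : ∀ᵐ p ∂ρ, ‖p.1‖ ≤ κ) (hY : ∀ᵐ p ∂ρ, |p.2| < M)
    {wstar : H} (hmin : risk ρ wstar = ⨅ w : H, risk ρ w)
    (hf : IsSpectralFilter κ a b c φ K) {n t : ℕ} (hn : 1 ≤ n) (ht : 1 ≤ t) (hφ : 0 < φ t)
    {z : Fin n → H × ℝ} (hz : ∀ i, ‖(z i).1‖ ≤ κ) {W : ℕ → H}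
    (hW : IsMomentumScheme a b c (empGrad z) W) (h0 : W 0 = 0)
    (hcov : ∀ v, n / 2 * ∫ p, inner ℝ v p.1 ^ 2 ∂ρ - ∑ i, inner ℝ v (z i).1 ^ 2 ≤
      n * κ ^ 2 * (1 / φ t) * ‖v‖ ^ 2) :
    excessRisk ρ (W t) ≤
      2 * (1 + κ ^ 2) * (K * (‖wstar‖ ^ 2 / φ t + φ t * ‖empGrad z wstar‖ ^ 2)) := by
  rw [excessRisk_eq hX hY hmin]
  have h1 := hf.norm_bound hz hW h0 wstar ht
  have h2 := hcov (W t - wstar)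
  set q := ∫ p, inner ℝ (W t - wstar) p.1 ^ 2 ∂ρ
  set S := ∑ i, inner ℝ (W t - wstar) (z i).1 ^ 2
  have hS : 0 ≤ S := Finset.sum_nonneg fun i _ => sq_nonneg _
  have hn0 : (0 : ℝ) < n := by exact_mod_cast hn
  have h3 : q ≤ 2 * (1 / n * S) + 2 * (κ ^ 2 * (1 / φ t * ‖W t - wstar‖ ^ 2)) := by
    have h4 : n / 2 * q ≤ n / 2 * (2 * (1 / n * S) +
        2 * (κ ^ 2 * (1 / φ t * ‖W t - wstar‖ ^ 2))) := by
      have : n / 2 * (2 * (1 / n * S) + 2 * (κ ^ 2 * (1 / φ t * ‖W t - wstar‖ ^ 2))) =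
          S + n * κ ^ 2 * (1 / φ t) * ‖W t - wstar‖ ^ 2 := by field_simp
      rw [this]
      linarith
    exact le_of_mul_le_mul_left h4 (by positivity)
  have h5 : 0 ≤ 1 / n * S := by positivity
  have h6 : 0 ≤ 1 / φ t * ‖W t - wstar‖ ^ 2 := by positivity
  have h7 : 2 * (1 + κ ^ 2) * (1 / n * S + 1 / φ t * ‖W t - wstar‖ ^ 2) ≤
      2 * (1 + κ ^ 2) * (K * (‖wstar‖ ^ 2 / φ t + φ t * ‖empGrad z wstar‖ ^ 2)) := by gcongr
  nlinarith [mul_nonneg (sq_nonneg κ) h5]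

lemma log_four_div_add_half_le {δ : ℝ} (hδ : 0 < δ) (hδ' : δ < 1 / 2) :
    0 ≤ Real.log (4 / δ) + 1 / 2 ∧ Real.log (4 / δ) + 1 / 2 ≤ 3 * Real.log (2 / δ) ∧
      1 ≤ Real.log (2 / δ) := by
  have h4 : 4 < 2 / δ := by rw [lt_div_iff₀ hδ]; linarith
  have h1 : 1 ≤ Real.log (2 / δ) := by
    rw [Real.le_log_iff_exp_le (by linarith)]
    linarith [Real.exp_one_lt_d9]
  have h2 : Real.log (4 / δ) = Real.log 2 + Real.log (2 / δ) := by
    rw [← Real.log_mul (by norm_num) (by positivity)]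
    congr 1
    ring
  have h3 := Real.log_two_lt_d9
  have h5 := Real.log_two_gt_d9
  refine ⟨by rw [h2]; linarith, by rw [h2]; linarith, h1⟩

/-- The excess risk bound for every spectral method, with `c = 16`. -/
theorem IsSpectralMethod.excessRisk_bound (hκ : 0 < κ) (hM : 0 < M)
    (hX : ∀ᵐ p ∂ρ, ‖p.1‖ ≤ κ) (hY : ∀ᵐ p ∂ρ, |p.2| < M)
    {wstar : H} (hmin : risk ρ wstar = ⨅ w : H, risk ρ w) {w : Method H} {φ : ℕ → ℝ}
    (hw : IsSpectralMethod κ φ w) (hφ : ∀ t, 1 ≤ t → 1 ≤ φ t) :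
    ∃ C : ℝ, 0 < C ∧ ∀ (δ : ℝ) (n t : ℕ), 0 < δ → δ < 1 / 2 → 1 ≤ n → 1 ≤ t →
      16 * φ t * Real.log (16 * φ t / δ) ≤ (n : ℝ) →
      1 - δ ≤ (sampleLaw ρ n).real
        {z | excessRisk ρ (w n z t) ≤
          C * (1 / φ t + φ t / n) * Real.log (2 / δ) ^ 2} := by
  obtain ⟨a, b, c, K, hK, hf, hscheme⟩ := hw
  set B := (‖wstar‖ * κ + M) * κ with hB
  have hB0 : 0 < B := by positivity
  refine ⟨2 * (1 + κ ^ 2) * K * (‖wstar‖ ^ 2 + 9 * B ^ 2), by positivity,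
    fun δ n t hδ hδ' hn ht hnt => ?_⟩
  have hφt := hφ t ht
  have hφ0 : 0 < φ t := by linarith
  have hn0 : (0 : ℝ) < n := by exact_mod_cast hn
  obtain ⟨p, hp0, hpn, hpδ⟩ := exists_tail_exponent hφt hδ hδ' hnt
  obtain ⟨hL0, hL, hℓ⟩ := log_four_div_add_half_le hδ hδ'
  have : IsProbabilityMeasure (sampleLaw ρ n) := by unfold sampleLaw; infer_instance
  let ξ : H × ℝ → H := fun q => (inner ℝ wstar q.1 - q.2) • q.1
  have hξ : Measurable ξ :=
    ((measurable_const.inner measurable_fst).sub measurable_snd).smul measurable_fst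
  have hξB : ∀ᵐ q ∂ρ, ‖ξ q‖ ≤ B := by
    filter_upwards [hX, hY] with q hq hq'
    rw [norm_smul]
    have h1 : ‖(inner ℝ wstar q.1 : ℝ)‖ ≤ ‖wstar‖ * κ := (norm_inner_le_norm _ _).trans (by gcongr)
    have h3 : ‖inner ℝ wstar q.1 - q.2‖ ≤ ‖wstar‖ * κ + M :=
      (norm_sub_le _ _).trans (add_le_add h1 hq'.le)
    exact mul_le_mul h3 hq (norm_nonneg _) ((norm_nonneg _).trans h3)
  have hξmean : ∀ v, ∫ q, inner ℝ v (ξ q) ∂ρ = 0 := fun v => by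
    simp only [ξ, inner_smul_right]
    exact integral_residual_mul_inner_eq_zero hX hY hmin v
  set bad₁ : Set (Fin n → H × ℝ) := {z | ∃ v, n * κ ^ 2 * (1 / φ t) * ‖v‖ ^ 2 <
    n / 2 * ∫ q, inner ℝ v q.1 ^ 2 ∂ρ - ∑ i, inner ℝ v (z i).1 ^ 2} with hbad₁
  set bad₂ : Set (Fin n → H × ℝ) :=
    {z | B * √n * (Real.log (4 / δ) + 1 / 2) ≤ ‖∑ i, ξ (z i)‖} with hbad₂
  set bad₃ : Set (Fin n → H × ℝ) := {z | ¬ ∀ i, ‖(z i).1‖ ≤ κ} with hbad₃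
  have h1 : sampleLaw ρ n bad₁ ≤ ENNReal.ofReal (δ / 2) := by
    have hpδ0 : 0 < p / δ := by positivity
    have h1 := measure_lower_tail (μ := ρ) (ξ := Prod.fst) measurable_fst hκ hX hpn
      (by positivity : 0 ≤ 1 / φ t)
    have h2 : sampleLaw ρ n bad₁ * ENNReal.ofReal (p / δ) ≤ ENNReal.ofReal (p / 2) :=
      (mul_le_mul_right (ENNReal.ofReal_le_ofReal hpδ) _).trans h1
    have h3 : ENNReal.ofReal (p / 2) = ENNReal.ofReal (δ / 2) * ENNReal.ofReal (p / δ) := by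
      rw [← ENNReal.ofReal_mul (by positivity)]
      congr 1
      field_simp
    rw [h3] at h2
    exact (ENNReal.mul_le_mul_iff_left (by simpa using hpδ0) ENNReal.ofReal_ne_top).1 h2
  have h2 : sampleLaw ρ n bad₂ ≤ ENNReal.ofReal (δ / 2) := by
    refine (measure_norm_sum_ge_le ρ hξ hB0 hξB hξmean hn (Real.log (4 / δ))).trans ?_
    rw [Real.exp_neg, Real.exp_log (by positivity)]
    apply ENNReal.ofReal_le_ofReal
    apply le_of_eq
    field_simp
    norm_num
  have h3 : sampleLaw ρ n bad₃ = 0 := ae_iff.1 (ae_pi_forall hX n)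
  set good := {z | excessRisk ρ (w n z t) ≤ 2 * (1 + κ ^ 2) * K * (‖wstar‖ ^ 2 + 9 * B ^ 2) *
    (1 / φ t + φ t / n) * Real.log (2 / δ) ^ 2} with hgood
  have hsub : goodᶜ ⊆ bad₁ ∪ bad₂ ∪ bad₃ := by
    intro z hz
    by_contra hnot
    simp only [Set.mem_union, not_or] at hnot
    obtain ⟨⟨hz1, hz2⟩, hz3⟩ := hnot
    apply hz
    have hz3' : ∀ i, ‖(z i).1‖ ≤ κ := by simpa [hbad₃] using hz3
    have hcov : ∀ v, n / 2 * ∫ q, inner ℝ v q.1 ^ 2 ∂ρ - ∑ i, inner ℝ v (z i).1 ^ 2 ≤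
        n * κ ^ 2 * (1 / φ t) * ‖v‖ ^ 2 := fun v => not_lt.1 fun h => hz1 ⟨v, h⟩
    have hgrad : ‖empGrad z wstar‖ ^ 2 ≤ 9 * B ^ 2 * Real.log (2 / δ) ^ 2 / n := by
      have e1 : ‖empGrad z wstar‖ = 1 / n * ‖∑ i, ξ (z i)‖ := by
        rw [empGrad, samplingAdj, norm_smul, Real.norm_of_nonneg (by positivity)]
        rfl
      have e2 : ‖∑ i, ξ (z i)‖ ≤ B * √n * (3 * Real.log (2 / δ)) :=
        (not_le.1 hz2).le.trans (by gcongr)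
      rw [e1]
      calc (1 / n * ‖∑ i, ξ (z i)‖) ^ 2 ≤ (1 / n * (B * √n * (3 * Real.log (2 / δ)))) ^ 2 := by
            gcongr
        _ = 9 * B ^ 2 * Real.log (2 / δ) ^ 2 * (√n ^ 2 / n ^ 2) := by ring
        _ = _ := by
            rw [Real.sq_sqrt hn0.le]
            field_simp
    refine (excessRisk_le_of_good_sample hX hY hmin hf hn ht hφ0 hz3' (hscheme n z).2
      (hscheme n z).1 hcov).trans ?_
    have hℓ2 : 1 ≤ Real.log (2 / δ) ^ 2 := one_le_pow₀ hℓ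
    have e3 : ‖wstar‖ ^ 2 / φ t + φ t * ‖empGrad z wstar‖ ^ 2 ≤
        (‖wstar‖ ^ 2 + 9 * B ^ 2) * (1 / φ t + φ t / n) * Real.log (2 / δ) ^ 2 := by
      have e4 : ‖wstar‖ ^ 2 / φ t ≤ ‖wstar‖ ^ 2 / φ t * Real.log (2 / δ) ^ 2 :=
        le_mul_of_one_le_right (by positivity) hℓ2
      have e5 : φ t * ‖empGrad z wstar‖ ^ 2 ≤
          φ t * (9 * B ^ 2 * Real.log (2 / δ) ^ 2 / n) := by gcongr
      have e6 : 0 ≤ (‖wstar‖ ^ 2 * (φ t / n) + 9 * B ^ 2 * (1 / φ t)) * Real.log (2 / δ) ^ 2 := by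
        positivity
      calc _ ≤ ‖wstar‖ ^ 2 / φ t * Real.log (2 / δ) ^ 2 +
            φ t * (9 * B ^ 2 * Real.log (2 / δ) ^ 2 / n) := add_le_add e4 e5
        _ ≤ ‖wstar‖ ^ 2 / φ t * Real.log (2 / δ) ^ 2 +
            φ t * (9 * B ^ 2 * Real.log (2 / δ) ^ 2 / n) +
            (‖wstar‖ ^ 2 * (φ t / n) + 9 * B ^ 2 * (1 / φ t)) * Real.log (2 / δ) ^ 2 := by
            linarith
        _ = _ := by ring
    have e7 : 2 * (1 + κ ^ 2) * (K * (‖wstar‖ ^ 2 / φ t + φ t * ‖empGrad z wstar‖ ^ 2)) ≤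
        2 * (1 + κ ^ 2) * (K * ((‖wstar‖ ^ 2 + 9 * B ^ 2) * (1 / φ t + φ t / n) *
          Real.log (2 / δ) ^ 2)) := by gcongr
    refine e7.trans (le_of_eq ?_)
    ring
  have h4 : sampleLaw ρ n goodᶜ ≤ ENNReal.ofReal δ := by
    calc sampleLaw ρ n goodᶜ ≤ sampleLaw ρ n (bad₁ ∪ bad₂ ∪ bad₃) := measure_mono hsub
      _ ≤ sampleLaw ρ n bad₁ + sampleLaw ρ n bad₂ + sampleLaw ρ n bad₃ :=
          (measure_union_le _ _).trans (by gcongr; exact measure_union_le _ _)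
      _ ≤ ENNReal.ofReal (δ / 2) + ENNReal.ofReal (δ / 2) + 0 := by
          rw [h3]; gcongr
      _ = ENNReal.ofReal δ := by
          rw [add_zero, ← ENNReal.ofReal_add (by positivity) (by positivity), add_halves]
  have h5 : (sampleLaw ρ n).real goodᶜ ≤ δ := ENNReal.toReal_le_of_le_ofReal hδ.le h4
  have h6 : (sampleLaw ρ n).real Set.univ ≤
      (sampleLaw ρ n).real good + (sampleLaw ρ n).real goodᶜ := by
    rw [← Set.union_compl_self good]
    exact measureReal_union_le _ _
  rw [probReal_univ] at h6
  linarith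

end Main

lemma eventually_mul_log_le_of_le_sqrt {b δ : ℝ} (hb : 0 < b) (hδ : 0 < δ) :
    ∀ᶠ n : ℕ in atTop, b * √n * Real.log (b * √n / δ) ≤ n := by
  have h1 := Real.isLittleO_log_id_atTop.def (by positivity : 0 < δ / b ^ 2)
  have h2 : Tendsto (fun n : ℕ => b * √(n : ℝ) / δ) atTop atTop :=
    ((Real.tendsto_sqrt_atTop.comp tendsto_natCast_atTop_atTop).const_mul_atTop hb).atTop_div_const
      hδ
  filter_upwards [h2.eventually h1] with n hn
  have h3 : Real.log (b * √n / δ) ≤ δ / b ^ 2 * (b * √n / δ) := by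
    refine (le_abs_self _).trans ?_
    simpa [abs_of_pos hb, abs_of_pos hδ, abs_of_nonneg (Real.sqrt_nonneg _)] using hn
  calc b * √n * Real.log (b * √n / δ) ≤ b * √n * (δ / b ^ 2 * (b * √n / δ)) := by gcongr
    _ = √n ^ 2 := by field_simp
    _ = n := Real.sq_sqrt (Nat.cast_nonneg n)

/-- Early stopping: if the regularization parameter `1 / φ` at the stopping time is of exact order
`n^{-1/2}`, the two terms of the bound balance. -/
lemma eventually_bound_of_isTheta_sqrt {φ : ℕ → ℝ} {P : ℕ → ℕ → ℝ → ℝ → Prop} {C : ℝ} (hC : 0 < C)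
    (hφ0 : φ 0 = 0) (hφ : ∀ t, 1 ≤ t → 1 ≤ φ t)
    (hmono : ∀ n t δ r r', r ≤ r' → P n t δ r → P n t δ r')
    (hP : ∀ (δ : ℝ) (n t : ℕ), 0 < δ → δ < 1 / 2 → 1 ≤ n → 1 ≤ t →
      16 * φ t * Real.log (16 * φ t / δ) ≤ (n : ℝ) → P n t δ (C * (1 / φ t + φ t / n)))
    {τ : ℕ → ℕ} (hτ : (fun n => φ (τ n)) =Θ[atTop] fun n : ℕ => √(n : ℝ)) :
    ∃ C' : ℝ, 0 < C' ∧ ∀ δ : ℝ, 0 < δ → δ < 1 / 2 → ∀ᶠ n : ℕ in atTop,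
      P n (τ n) δ (C' * (1 / √(n : ℝ))) := by
  obtain ⟨b, hb, hub⟩ := hτ.1.exists_pos
  obtain ⟨a, ha, hlb⟩ := hτ.2.exists_pos
  refine ⟨C * (a + b), by positivity, fun δ hδ hδ' => ?_⟩
  filter_upwards [hub.bound, hlb.bound, eventually_ge_atTop 1,
    eventually_mul_log_le_of_le_sqrt (by positivity : 0 < 16 * b) hδ] with n h1 h2 hn h3
  have hn0 : (0 : ℝ) < n := by exact_mod_cast hn
  have hs : 0 < √(n : ℝ) := Real.sqrt_pos.2 hn0
  have hτ1 : 1 ≤ τ n := by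
    rcases Nat.eq_zero_or_pos (τ n) with h | h
    · rw [h, hφ0, norm_zero, mul_zero, Real.norm_of_nonneg hs.le] at h2
      linarith
    · exact h
  have hφ1 := hφ _ hτ1
  have hφpos : 0 < φ (τ n) := by linarith
  rw [Real.norm_of_nonneg hs.le, Real.norm_of_nonneg hφpos.le] at h1 h2
  refine hmono _ _ _ _ _ ?_ (hP δ n (τ n) hδ hδ' hn hτ1 ?_)
  · have h4 : 1 / φ (τ n) ≤ a * (1 / √n) := by
      rw [mul_one_div, div_le_div_iff₀ hφpos hs]
      linarith
    have h5 : φ (τ n) / n ≤ b * (1 / √n) := by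
      rw [mul_one_div, div_le_div_iff₀ hn0 hs]
      calc φ (τ n) * √n ≤ b * √n * √n := by gcongr
        _ = b * n := by rw [mul_assoc, Real.mul_self_sqrt hn0.le]
    calc C * (1 / φ (τ n) + φ (τ n) / n) ≤ C * (a * (1 / √n) + b * (1 / √n)) := by gcongr
      _ = _ := by ring
  · refine le_trans ?_ h3
    have h6 : 16 * φ (τ n) ≤ 16 * b * √n := by linarith
    have h7 : 1 ≤ 16 * φ (τ n) / δ := by
      rw [le_div_iff₀ hδ]; linarith
    refine mul_le_mul h6 (Real.log_le_log (by linarith) (by gcongr)) (Real.log_nonneg h7)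
      (by positivity)

end LeastSquares

theorem mainTheorem3 {H : Type*} [NormedAddCommGroup H] [InnerProductSpace ℝ H] [CompleteSpace H]
    [TopologicalSpace.SeparableSpace H] [MeasurableSpace H] [BorelSpace H]
    (ρ : Measure (H × ℝ)) [IsProbabilityMeasure ρ]
    (κ : ℝ) (hκ : 0 < κ)
    (hX : ∀ᵐ x ∂ρ.fst, ∀ᵐ x' ∂ρ.fst, inner ℝ x x' ≤ κ ^ 2)
    (M : ℝ) (hM : 0 < M) (hY : ∀ᵐ p ∂ρ, |p.2| < M)
    (hmin : ∃ wstar : H, LeastSquares.risk ρ wstar = ⨅ w : H, LeastSquares.risk ρ w)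
    (wGD wAcc : LeastSquares.Method H)
    (hGD : LeastSquares.IsGradientDescent κ wGD) (hAcc : LeastSquares.IsAccelerated κ wAcc) :
    (∃ C₁ c₁ : ℝ, 0 < C₁ ∧ 0 < c₁ ∧ ∀ (δ : ℝ) (n t : ℕ), 0 < δ → δ < 1 / 2 → 1 ≤ n → 1 ≤ t →
      c₁ * (t : ℝ) * Real.log (c₁ * (t : ℝ) / δ) ≤ (n : ℝ) →
      1 - δ ≤ (LeastSquares.sampleLaw ρ n).real
        {z | LeastSquares.excessRisk ρ (wGD n z t) ≤
          C₁ * (1 / (t : ℝ) + (t : ℝ) / (n : ℝ)) * Real.log (2 / δ) ^ 2}) ∧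
    (∃ C₂ c₂ : ℝ, 0 < C₂ ∧ 0 < c₂ ∧ ∀ (δ : ℝ) (n t : ℕ), 0 < δ → δ < 1 / 2 → 1 ≤ n → 1 ≤ t →
      c₂ * (t : ℝ) ^ 2 * Real.log (c₂ * (t : ℝ) ^ 2 / δ) ≤ (n : ℝ) →
      1 - δ ≤ (LeastSquares.sampleLaw ρ n).real
        {z | LeastSquares.excessRisk ρ (wAcc n z t) ≤
          C₂ * (1 / (t : ℝ) ^ 2 + (t : ℝ) ^ 2 / (n : ℝ)) * Real.log (2 / δ) ^ 2}) ∧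
    (∀ τ : ℕ → ℕ, (fun n => (τ n : ℝ)) =Θ[atTop] (fun n : ℕ => (n : ℝ) ^ (1 / 2 : ℝ)) →
      ∃ C : ℝ, 0 < C ∧ ∀ δ : ℝ, 0 < δ → δ < 1 / 2 → ∀ᶠ n : ℕ in atTop,
        1 - δ ≤ (LeastSquares.sampleLaw ρ n).real
          {z | LeastSquares.excessRisk ρ (wGD n z (τ n)) ≤
            C * (1 / Real.sqrt (n : ℝ)) * Real.log (2 / δ) ^ 2}) ∧
    (∀ τ : ℕ → ℕ, (fun n => (τ n : ℝ)) =Θ[atTop] (fun n : ℕ => (n : ℝ) ^ (1 / 4 : ℝ)) →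
      ∃ C : ℝ, 0 < C ∧ ∀ δ : ℝ, 0 < δ → δ < 1 / 2 → ∀ᶠ n : ℕ in atTop,
        1 - δ ≤ (LeastSquares.sampleLaw ρ n).real
          {z | LeastSquares.excessRisk ρ (wAcc n z (τ n)) ≤
            C * (1 / Real.sqrt (n : ℝ)) * Real.log (2 / δ) ^ 2}) := by
  have hX' : ∀ᵐ p ∂ρ, ‖p.1‖ ≤ κ :=
    ae_of_ae_map measurable_fst.aemeasurable (LeastSquares.ae_norm_le_of_ae_inner_le _ hκ hX)
  obtain ⟨wstar, hw⟩ := hmin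
  have hφ₁ : ∀ t : ℕ, 1 ≤ t → (1 : ℝ) ≤ (t : ℝ) := fun t ht => by exact_mod_cast ht
  have hφ₂ : ∀ t : ℕ, 1 ≤ t → (1 : ℝ) ≤ (t : ℝ) ^ 2 := fun t ht => one_le_pow₀ (hφ₁ t ht)
  obtain ⟨C₁, hC₁, h₁⟩ := (hGD.isSpectralMethod hκ).excessRisk_bound hκ hM hX' hY hw hφ₁
  obtain ⟨C₂, hC₂, h₂⟩ := (hAcc.isSpectralMethod hκ).excessRisk_bound hκ hM hX' hY hw hφ₂
  have hmono : ∀ (w : LeastSquares.Method H) (n t : ℕ) (δ r r' : ℝ), r ≤ r' →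
      1 - δ ≤ (LeastSquares.sampleLaw ρ n).real
        {z | LeastSquares.excessRisk ρ (w n z t) ≤ r * Real.log (2 / δ) ^ 2} →
      1 - δ ≤ (LeastSquares.sampleLaw ρ n).real
        {z | LeastSquares.excessRisk ρ (w n z t) ≤ r' * Real.log (2 / δ) ^ 2} := by
    intro w n t δ r r' hr h
    have : IsProbabilityMeasure (LeastSquares.sampleLaw ρ n) := by
      unfold LeastSquares.sampleLaw; infer_instance
    exact h.trans (measureReal_mono fun z hz =>
      le_trans hz (mul_le_mul_of_nonneg_right hr (sq_nonneg _)))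
  refine ⟨⟨C₁, 16, hC₁, by norm_num, h₁⟩, ⟨C₂, 16, hC₂, by norm_num, h₂⟩, fun τ hτ => ?_,
    fun τ hτ => ?_⟩
  · exact LeastSquares.eventually_bound_of_isTheta_sqrt hC₁ (by simp) hφ₁ (hmono wGD) h₁
      (by simpa only [Real.sqrt_eq_rpow] using hτ)
  · refine LeastSquares.eventually_bound_of_isTheta_sqrt hC₂ (by simp) hφ₂ (hmono wAcc) h₂ ?_
    have h := hτ.pow 2
    refine h.trans_eventuallyEq (Eventually.of_forall fun n => ?_)
    simp only
    rw [Real.sqrt_eq_rpow, ← Real.rpow_natCast, ← Real.rpow_mul (Nat.cast_nonneg n)]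
    norm_num
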